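/- Let $n,m,p_1,p_2,q_1,q_2\ge 0$ be integers, let $f:\mathbb R^n\times\mathbb R^m\to\mathbb R$, $\phi:\mathbb R^n\to\mathbb R^{p_1+p_2}$ and $\varphi:\mathbb R^n\times\mathbb R^m\to\mathbb R^{q_1+q_2}$ be twice continuously differentiable, and put $C=\mathbb R_-^{p_1}\times\{0\}^{p_2}$, $D=\mathbb R_-^{q_1}\times\{0\}^{q_2}$, $X=\{x:\phi(x)\in C\}$, $Y(x)=\{y:\varphi(x,y)\in D\}$. Let $\bar x\in X$ and $\bar y\in Y(\bar x)$. For $\delta>0$ put $$V_\delta(x)=\max\{f(x,y): y\in Y(x),\ \|y-\bar y\|\le\delta\},$$ and let $S_\delta(x)$ be the set of maximizers. We use the following notation. * $L_{\max}(x,y,\beta)=f(x,y)-\varphi(x,y)^T\beta$. The multiplier set $\Lambda_{\max}$ consists of all $\beta=(\beta_1,\beta_2)\in\mathbb R^{q_1}_+\times\mathbb R^{q_2}$ with $\nabla_yL_{\max}(\bar x,\bar y,\beta)=0$ and $\beta_{1,i}\varphi_i(\bar x,\bar y)=0$ for $i\le q_1$. For $u\in\mathbb R^n$, $\Lambda^2_{\max}(u)=\operatorname{argmin}_{\beta\in\Lambda_{\max}}\nabla_xL_{\max}(\bar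 x,\bar y,\beta)^Tu$. * $\mathbb L_X=\{u:\nabla\phi_i(\bar x)^Tu\le0\ (i\le p_1,\ \phi_i(\bar x)=0),\ \nabla\phi_j(\bar x)^Tu=0\ (p_1<j\le p_1+p_2)\}$. * $\mathbb L(u)=\{h:\nabla\varphi_i(\bar x,\bar y)^T(u,h)\le0\ (i\le q_1,\ \varphi_i(\bar x,\bar y)=0),\ \nabla\varphi_j(\bar x,\bar y)^T(u,h)=0\ (q_1<j\le q_1+q_2)\}$, and $\mathbb L^2(u)=\operatorname{argmax}_{h\in\mathbb L(u)}\nabla f(\bar x,\bar y)^T(u,h)$. * $C_{\min}=\{u\in\mathbb L_X:\sup_{h\in\mathbb L(u)}\nabla f(\bar x,\bar y)^T(u,h)\le0\}$ and $C^0_{\min}=\{u\in\mathbb L_X:\max_{h\in\mathbb L(u)}\nabla f(\bar x,\bar y)^T(u,h)=0\}\subseteq C_{\min}$. * $C_{\max}=\{h\in T_{Y(\bar x)}(\bar y):\nabla_yf(\bar x,\bar y)^Th\ge0\}$, where $T$ is the contingent cone. * SSOSC$_u$ means: $\Lambda_{\max}\neq\emptyset$ and $\inf_{\beta\in\Lambda^2_{\max}(u)}h^T\nabla^2_{yy}L_{\max}(\bar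 x,\bar y,\beta)h<0$ for all $h\in C_{\max}\setminus\{0\}$. For a function $\psi$, $\psi'(x;u)=\lim_{t\downarrow0}\frac{\psi(x+tu)-\psi(x)}{t}$ and $\psi''(x;u)=\lim_{t\downarrow0}\frac{\psi(x+tu)-\psi(x)-t\psi'(x;u)}{t^2/2}$; $\psi$ is twice directionally differentiable at $x$ in direction $u$ if both limits exist and are finite. Suppose that MFCQ holds for the system $\varphi(\bar x,y)\in D$ at $\bar y$, i.e. the gradients $\nabla_y\varphi_j(\bar x,\bar y)$, $q_1<j\le q_1+q_2$, are linearly independent and there is $w\in\mathbb R^m$ with $\nabla_y\varphi_j(\bar x,\bar y)^Tw=0$ for these $j$ and $\nabla_y\varphi_i(\bar x,\bar y)^Tw<0$ for all $i\le q_1$ with $\varphi_i(\bar x,\bar y)=0$. Suppose that SSOSC$_u$ holds for every $u\in C^0_{\min}\setminus\{0\}$, and let $\delta>0$ be such that $S_\delta(\bar x)=\{\bar y\}$. Then: 1. there is a neighbourhood of $\bar x$ on which the maximum defining $V_\delta$ is attained and $V_\delta$ is Lipschitz continuous; 2. $V_\delta$ is twice directionally differentiable at $\bar x$ in every direction $u\in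 C^0_{\min}$; 3. for every $u\in C_{\min}\setminus\{0\}$ that lies in $C^0_{\min}$ or, more generally, satisfies SSOSC$_u$, $V_\delta$ is twice directionally differentiable at $\bar x$ in direction $u$ and $$V_\delta''(\bar x;u)\ \ge\ \max_{h\in\mathbb L^2(u)}\ \min_{\beta\in\Lambda^2_{\max}(u)}\nabla^2_{(x,y)}L_{\max}(\bar x,\bar y,\beta)((u,h),(u,h)),$$ where the minimum (for each $h\in\mathbb L^2(u)$) and the maximum are attained. -/

import Mathlib

open Filter Topology

/-- The `k`-dimensional Euclidean space. -/
abbrev Vec (k : ℕ) : Type := EuclideanSpace ℝ (Fin k)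

/-- Data of the coupled-constrained minimax problem `min_{x ∈ X} max_{y ∈ Y(x)} f(x,y)`, where
`X = {x | ϕ(x) ∈ C}`, `Y(x) = {y | φ(x,y) ∈ D}`, `C = ℝ₋^{p₁} × {0}^{p₂}`, `D = ℝ₋^{q₁} × {0}^{q₂}`.
The maps `ϕ` and `φ` are split into their inequality and equality components. -/
structure MinimaxData (n m p₁ p₂ q₁ q₂ : ℕ) where
  /-- the objective `f` -/
  f : Vec n × Vec m → ℝ
  /-- inequality components of `ϕ` -/
  outerIneq : Fin p₁ → Vec n → ℝ
  /-- equality components of `ϕ` -/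
  outerEq : Fin p₂ → Vec n → ℝ
  /-- inequality components of `φ` -/
  innerIneq : Fin q₁ → Vec n × Vec m → ℝ
  /-- equality components of `φ` -/
  innerEq : Fin q₂ → Vec n × Vec m → ℝ

namespace MinimaxData

variable {n m p₁ p₂ q₁ q₂ : ℕ} (P : MinimaxData n m p₁ p₂ q₁ q₂)

/-- All data are twice continuously differentiable. -/
def IsC2 : Prop :=
  ContDiff ℝ 2 P.f ∧
    (∀ i, ContDiff ℝ 2 (P.outerIneq i)) ∧ (∀ j, ContDiff ℝ 2 (P.outerEq j)) ∧
    (∀ i, ContDiff ℝ 2 (P.innerIneq i)) ∧ (∀ j, ContDiff ℝ 2 (P.innerEq j))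

/-- The outer feasible set `X`. -/
def X : Set (Vec n) :=
  {x | (∀ i, P.outerIneq i x ≤ 0) ∧ ∀ j, P.outerEq j x = 0}

/-- The inner feasible set `Y(x)`. -/
def Y (x : Vec n) : Set (Vec m) :=
  {y | (∀ i, P.innerIneq i (x, y) ≤ 0) ∧ ∀ j, P.innerEq j (x, y) = 0}

/-- The localized feasible set `Y(x) ∩ 𝔹_δ(ȳ)`. -/
def localY (yb : Vec m) (δ : ℝ) (x : Vec n) : Set (Vec m) :=
  P.Y x ∩ Metric.closedBall yb δ

/-- The localized value function `V_δ(x) = max {f(x,y) | y ∈ Y(x) ∩ 𝔹_δ(ȳ)}`. -/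
noncomputable def V (yb : Vec m) (δ : ℝ) (x : Vec n) : ℝ :=
  sSup ((fun y => P.f (x, y)) '' P.localY yb δ x)

/-- The localized solution set `S_δ(x) = argmax {f(x,y) | y ∈ Y(x) ∩ 𝔹_δ(ȳ)}`. -/
def S (yb : Vec m) (δ : ℝ) (x : Vec n) : Set (Vec m) :=
  {y | y ∈ P.localY yb δ x ∧ ∀ y' ∈ P.localY yb δ x, P.f (x, y') ≤ P.f (x, y)}

/-- The Mangasarian-Fromovitz constraint qualification for the system `φ(x̄,y) ∈ D` at `ȳ`. -/
def MFCQ (xb : Vec n) (yb : Vec m) : Prop :=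
  LinearIndependent ℝ (fun j => fderiv ℝ (fun y => P.innerEq j (xb, y)) yb) ∧
    ∃ w : Vec m,
      (∀ j, fderiv ℝ (fun y => P.innerEq j (xb, y)) yb w = 0) ∧
      ∀ i, P.innerIneq i (xb, yb) = 0 → fderiv ℝ (fun y => P.innerIneq i (xb, y)) yb w < 0

/-- The Lagrangian `L_max(x,y,β) = f(x,y) - φ(x,y)ᵀβ` of the inner problem. -/
noncomputable def Lmax (β : (Fin q₁ → ℝ) × (Fin q₂ → ℝ)) (z : Vec n × Vec m) : ℝ :=
  P.f z - ((∑ i, β.1 i * P.innerIneq i z) + ∑ j, β.2 j * P.innerEq j z)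

/-- The set `Λ_max(ȳ; x̄)` of multipliers of the inner problem. -/
def multipliers (xb : Vec n) (yb : Vec m) : Set ((Fin q₁ → ℝ) × (Fin q₂ → ℝ)) :=
  {β | (∀ i, 0 ≤ β.1 i) ∧ (∀ i, β.1 i * P.innerIneq i (xb, yb) = 0) ∧
    fderiv ℝ (fun y => P.Lmax β (xb, y)) yb = 0}

/-- The set `Λ²_max(x̄,ȳ,u)` of the multipliers that minimize
`∇ₓ f(x̄,ȳ)ᵀ u - (∇ₓ φ(x̄,ȳ)ᵀ β)ᵀ u`. -/
def multipliers2 (xb : Vec n) (yb : Vec m) (u : Vec n) :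
    Set ((Fin q₁ → ℝ) × (Fin q₂ → ℝ)) :=
  {β | β ∈ P.multipliers xb yb ∧ ∀ β' ∈ P.multipliers xb yb,
    fderiv ℝ (fun x => P.Lmax β (x, yb)) xb u ≤ fderiv ℝ (fun x => P.Lmax β' (x, yb)) xb u}

/-- The linearization cone `𝕃_X(x̄)`. -/
def linX (xb : Vec n) : Set (Vec n) :=
  {u | (∀ i, P.outerIneq i xb = 0 → fderiv ℝ (P.outerIneq i) xb u ≤ 0) ∧
    ∀ j, fderiv ℝ (P.outerEq j) xb u = 0}

/-- The set `𝕃(x̄,ȳ;u)` of the `h` with `∇φ(x̄,ȳ)(u,h) ∈ T_D(φ(x̄,ȳ))`. -/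
def linY (xb : Vec n) (yb : Vec m) (u : Vec n) : Set (Vec m) :=
  {h | (∀ i, P.innerIneq i (xb, yb) = 0 → fderiv ℝ (P.innerIneq i) (xb, yb) (u, h) ≤ 0) ∧
    ∀ j, fderiv ℝ (P.innerEq j) (xb, yb) (u, h) = 0}

/-- The set `𝕃²(x̄,ȳ;u)` of the maximizers of `h ↦ ∇f(x̄,ȳ)ᵀ(u,h)` over `𝕃(x̄,ȳ;u)`. -/
def linY2 (xb : Vec n) (yb : Vec m) (u : Vec n) : Set (Vec m) :=
  {h | h ∈ P.linY xb yb u ∧ ∀ h' ∈ P.linY xb yb u,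
    fderiv ℝ P.f (xb, yb) (u, h') ≤ fderiv ℝ P.f (xb, yb) (u, h)}

/-- The critical cone `C_min(x̄,ȳ)`: the `u ∈ 𝕃_X(x̄)` such that the supremum of
`∇f(x̄,ȳ)ᵀ(u,h)` over `h ∈ 𝕃(x̄,ȳ;u)` is at most `0`. -/
def Cmin (xb : Vec n) (yb : Vec m) : Set (Vec n) :=
  {u | u ∈ P.linX xb ∧ ∀ h ∈ P.linY xb yb u, fderiv ℝ P.f (xb, yb) (u, h) ≤ 0}

/-- The `u ∈ 𝕃_X(x̄)` such that the maximum of `∇f(x̄,ȳ)ᵀ(u,h)` over `h ∈ 𝕃(x̄,ȳ;u)`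
is equal to `0`. -/
def Cmin0 (xb : Vec n) (yb : Vec m) : Set (Vec n) :=
  {u | u ∈ P.linX xb ∧
    IsGreatest ((fun h => fderiv ℝ P.f (xb, yb) (u, h)) '' P.linY xb yb u) 0}

/-- The critical cone `C_max(ȳ; x̄)` of the inner problem; `posTangentConeAt` is the
contingent cone. -/
def Cmax (xb : Vec n) (yb : Vec m) : Set (Vec m) :=
  {h | h ∈ posTangentConeAt (P.Y xb) yb ∧ 0 ≤ fderiv ℝ (fun y => P.f (xb, y)) yb h}

/-- The strong second-order sufficient condition in direction `u`. The infimum over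
`Λ²_max(x̄,ȳ,u)` is negative exactly when one of the values is. -/
def SSOSC (xb : Vec n) (yb : Vec m) (u : Vec n) : Prop :=
  (P.multipliers xb yb).Nonempty ∧
    ∀ h ∈ P.Cmax xb yb, h ≠ 0 → ∃ β ∈ P.multipliers2 xb yb u,
      fderiv ℝ (fderiv ℝ (fun y => P.Lmax β (xb, y))) yb h h < 0

/-- The value `∇²_{(x,y)} L_max(x̄,ȳ,β)((u,h),(u,h))`. -/
noncomputable def hessL (xb : Vec n) (yb : Vec m) (u : Vec n) (h : Vec m)
    (β : (Fin q₁ → ℝ) × (Fin q₂ → ℝ)) : ℝ :=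
  fderiv ℝ (fderiv ℝ (P.Lmax β)) (xb, yb) (u, h) (u, h)

end MinimaxData

/-- `ψ` has the (one-sided) directional derivative `v = ψ'(x;u)`. -/
def HasDirDeriv {k : ℕ} (ψ : Vec k → ℝ) (x u : Vec k) (v : ℝ) : Prop :=
  Tendsto (fun t : ℝ => (ψ (x + t • u) - ψ x) / t) (𝓝[>] 0) (𝓝 v)

/-- `ψ` is twice directionally differentiable at `x` in direction `u`, and `d = ψ''(x;u)`. -/
def HasSecondDirDeriv {k : ℕ} (ψ : Vec k → ℝ) (x u : Vec k) (d : ℝ) : Prop :=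
  ∃ v : ℝ, HasDirDeriv ψ x u v ∧
    Tendsto (fun t : ℝ => (ψ (x + t • u) - ψ x - t * v) / (t ^ 2 / 2)) (𝓝[>] 0) (𝓝 d)

/-! In every direction `u` satisfying SSOSC the second derivative of the value function exists and
equals the max-min of Hessians, so the asserted bound holds there with equality. The first
derivative `v` is the minimum of the linear function `∇ₓL(β)ᵀu` over the multipliers; by linear
programming duality it is also the maximum of `∇f(u,h)` over `linY`.

Lower estimate: fix `h` in `linY2` and let `q` be the least Hessian value over `multipliers2`.
Duality for the second-order linearized problem (`MFCQ.exists_second_order`) supplies an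
acceleration `k` such that the parabola `yb + t h + (t²/2) k` is feasible up to `o(t²)` and gains at
least `q` at second order. Robinson stability (`MFCQ.robinson`, `MFCQ.exists_correction`) repairs
feasibility at a cost of `o(t²)`.

Upper estimate: if the quotient stayed at or above `a` along some `t → 0`, choose maximizers and
normalize the pairs `(t, y - yb)` jointly. The limit `(τ, η)` is a unit vector. Since the Lagrangian
dominates `f` on the feasible set, Taylor expansion gives `τ² a ≤ hessL (τ u) η β` for all `β` in
`multipliers2`. If `τ = 0`, then `η` is a nonzero critical direction forbidden by SSOSC; if `τ > 0`,
then `η / τ` contradicts the choice of `a` above the max-min. No rate of convergence of the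
maximizers has to be known beforehand.

MFCQ makes the multiplier set compact, so the inner minimum is attained; SSOSC bounds the superlevel
sets in `h`, so the outer maximum is attained. The Lipschitz property follows from the Aubin
property of the feasible map together with the convergence of maximizers to `yb`. -/

/-! ### Linear programming duality. -/

/-- **Farkas' lemma** for finitely many linear functionals on a real vector space. -/
theorem farkas_finset {V ι : Type*} [AddCommGroup V] [Module ℝ V] [DecidableEq ι] (s : Finset ι) :
    ∀ (A : ι → V →ₗ[ℝ] ℝ) (c : V →ₗ[ℝ] ℝ), (∀ x, (∀ i ∈ s, A i x ≤ 0) → c x ≤ 0) →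
      ∃ l : ι → ℝ, (∀ i, 0 ≤ l i) ∧ c = ∑ i ∈ s, l i • A i := by
  induction s using Finset.induction_on with
  | empty =>
    intro A c h
    refine ⟨0, fun _ => le_rfl, ?_⟩
    ext x
    have h1 := h x (by simp)
    have h2 := h (-x) (by simp)
    rw [map_neg] at h2
    simp only [Finset.sum_empty, LinearMap.zero_apply]
    linarith
  | insert j s hj ih =>
    intro A c h
    by_cases hc : ∀ x, (∀ i ∈ s, A i x ≤ 0) → c x ≤ 0
    · obtain ⟨l, hl, hcl⟩ := ih A c hc
      refine ⟨Function.update l j 0, fun i => ?_, ?_⟩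
      · by_cases hij : i = j
        · simp [hij]
        · simp [hij, hl i]
      · rw [Finset.sum_insert hj, hcl]
        simp only [Function.update_self, zero_smul, zero_add]
        refine Finset.sum_congr rfl fun i hi => ?_
        rw [Function.update_of_ne (ne_of_mem_of_not_mem hi hj)]
    · push Not at hc
      obtain ⟨x₁, hx₁, hcx₁⟩ := hc
      have hjx₁ : 0 < A j x₁ := by
        by_contra! hneg
        exact absurd (h x₁ fun i hi => by
          rcases Finset.mem_insert.1 hi with rfl | hi
          · exact hneg
          · exact hx₁ i hi) (not_le.2 hcx₁)
      obtain ⟨x₀, hx₀, hcx₀, hjx₀⟩ : ∃ x₀, (∀ i ∈ s, A i x₀ ≤ 0) ∧ 0 < c x₀ ∧ A j x₀ = 1 := by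
        refine ⟨(A j x₁)⁻¹ • x₁, fun i hi => ?_, ?_, ?_⟩
        · rw [map_smul, smul_eq_mul]
          exact mul_nonpos_of_nonneg_of_nonpos (inv_pos.2 hjx₁).le (hx₁ i hi)
        · rw [map_smul, smul_eq_mul]
          exact mul_pos (inv_pos.2 hjx₁) hcx₁
        · rw [map_smul, smul_eq_mul, inv_mul_cancel₀ hjx₁.ne']
      -- These are the functionals composed with the projection `x ↦ x - A j x • x₀` onto the kernel
      -- of `A j`, where the constraint `j` is harmless. The coefficient of `A j` recovered
      -- afterwards is nonnegative because `c x₀ > 0` and `A i x₀ ≤ 0` on `s`.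
      obtain ⟨l, hl, hcl⟩ := ih (fun i => A i - A i x₀ • A j) (c - c x₀ • A j) (fun x hx => by
        have := h (x - A j x • x₀) (fun i hi => by
          rcases Finset.mem_insert.1 hi with rfl | hi
          · simp [hjx₀]
          · have := hx i hi
            simp only [LinearMap.sub_apply, LinearMap.smul_apply, smul_eq_mul] at this
            simp only [map_sub, map_smul, smul_eq_mul]
            linarith)
        simp only [map_sub, map_smul, smul_eq_mul] at this
        simp only [LinearMap.sub_apply, LinearMap.smul_apply, smul_eq_mul]
        linarith)
      have hcoef : 0 ≤ c x₀ - ∑ i ∈ s, l i * A i x₀ := by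
        have : ∑ i ∈ s, l i * A i x₀ ≤ 0 :=
          Finset.sum_nonpos fun i hi => mul_nonpos_of_nonneg_of_nonpos (hl i) (hx₀ i hi)
        linarith
      refine ⟨Function.update l j (c x₀ - ∑ i ∈ s, l i * A i x₀), fun i => ?_, ?_⟩
      · by_cases hij : i = j
        · subst hij; simpa using hcoef
        · simp [hij, hl i]
      · rw [Finset.sum_insert hj, Function.update_self]
        have hs : ∑ i ∈ s, Function.update l j (c x₀ - ∑ i ∈ s, l i * A i x₀) i • A i
            = ∑ i ∈ s, l i • A i := Finset.sum_congr rfl fun i hi => by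
          rw [Function.update_of_ne (ne_of_mem_of_not_mem hi hj)]
        rw [hs]
        have := hcl
        simp only [smul_sub, Finset.sum_sub_distrib, smul_smul, ← Finset.sum_smul] at this
        rw [sub_eq_iff_eq_add] at this
        refine this.trans ?_
        ext x
        simp only [LinearMap.add_apply, LinearMap.sub_apply, LinearMap.smul_apply, smul_eq_mul]
        ring

/-- **Strong duality of linear programming**: if a linear program is feasible in the dual sense
`hreg` and `d` is a lower bound of its dual, then some primal feasible point has value at
least `d`. Only the inequalities with `p i` are imposed. -/
theorem exists_le_of_forall_dual {V ι κ : Type*} [AddCommGroup V] [Module ℝ V] [Fintype ι]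
    [Fintype κ] (p : ι → Prop) (a : ι → V →ₗ[ℝ] ℝ) (α : ι → ℝ) (b : κ → V →ₗ[ℝ] ℝ) (γ : κ → ℝ)
    (c : V →ₗ[ℝ] ℝ) (d : ℝ)
    (hreg : ∀ (l : ι → ℝ) (r : κ → ℝ), (∀ i, 0 ≤ l i) → (∀ i, ¬ p i → l i = 0) →
      (∀ h, ∑ i, l i * a i h + ∑ j, r j * b j h = 0) → 0 ≤ ∑ i, l i * α i + ∑ j, r j * γ j)
    (hdual : ∀ (l : ι → ℝ) (r : κ → ℝ), (∀ i, 0 ≤ l i) → (∀ i, ¬ p i → l i = 0) →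
      (∀ h, ∑ i, l i * a i h + ∑ j, r j * b j h = c h) → d ≤ ∑ i, l i * α i + ∑ j, r j * γ j) :
    ∃ h, (∀ i, p i → a i h ≤ α i) ∧ (∀ j, b j h = γ j) ∧ d ≤ c h := by
  classical
  by_contra hno
  push Not at hno
  let π₁ : V × ℝ →ₗ[ℝ] V := LinearMap.fst ℝ V ℝ
  let π₂ : V × ℝ →ₗ[ℝ] ℝ := LinearMap.snd ℝ V ℝ
  -- Homogenization by a scale variable `s`: a solution with `s > 0` would give a primal point after
  -- division by `s`. Hence the system forces `s ≤ 0`, and Farkas applies to the functional `s`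
  -- itself.
  let A : ι ⊕ κ ⊕ κ ⊕ Bool → V × ℝ →ₗ[ℝ] ℝ := Sum.elim
    (fun i => if p i then (a i).comp π₁ - α i • π₂ else 0)
    (Sum.elim (fun j => (b j).comp π₁ - γ j • π₂) (Sum.elim (fun j => γ j • π₂ - (b j).comp π₁)
      (fun t => if t then d • π₂ - c.comp π₁ else -π₂)))
  obtain ⟨l, hl, hsum⟩ := farkas_finset Finset.univ A π₂ (by
    rintro ⟨x, s⟩ hx
    by_contra! hs
    change 0 < s at hs
    have e1 : ∀ i, p i → a i x ≤ α i * s := fun i hi => by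
      have := hx (Sum.inl i) (Finset.mem_univ _)
      simp [A, hi, π₁, π₂] at this
      exact this
    have e2 : ∀ j, b j x ≤ γ j * s := fun j => by
      have := hx (Sum.inr (Sum.inl j)) (Finset.mem_univ _)
      simp [A, π₁, π₂] at this
      exact this
    have e3 : ∀ j, γ j * s ≤ b j x := fun j => by
      have := hx (Sum.inr (Sum.inr (Sum.inl j))) (Finset.mem_univ _)
      simp [A, π₁, π₂] at this
      exact this
    have e4 : d * s ≤ c x := by
      have := hx (Sum.inr (Sum.inr (Sum.inr true))) (Finset.mem_univ _)
      simp [A, π₁, π₂] at this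
      exact this
    have := hno (s⁻¹ • x) (fun i hi => by
      rw [map_smul, smul_eq_mul, inv_mul_le_iff₀ hs, mul_comm]; exact e1 i hi) (fun j => by
      rw [map_smul, smul_eq_mul, inv_mul_eq_iff_eq_mul₀ hs.ne', mul_comm]
      exact le_antisymm (e2 j) (e3 j))
    rw [map_smul, smul_eq_mul, inv_mul_lt_iff₀ hs, mul_comm] at this
    linarith)
  set L : ι → ℝ := fun i => if p i then l (Sum.inl i) else 0 with hL
  set R : κ → ℝ := fun j => l (Sum.inr (Sum.inl j)) - l (Sum.inr (Sum.inr (Sum.inl j))) with hR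
  set ν := l (Sum.inr (Sum.inr (Sum.inr true)))
  set σ := l (Sum.inr (Sum.inr (Sum.inr false)))
  have hν : 0 ≤ ν := hl _
  have hσ : 0 ≤ σ := hl _
  have hL0 : ∀ i, 0 ≤ L i := fun i => by
    simp only [hL]; split_ifs; exacts [hl _, le_rfl]
  have hLp : ∀ i, ¬ p i → L i = 0 := fun i hi => by simp [hL, hi]
  have key : ∀ (x : V) (s : ℝ), s = (∑ i, L i * a i x + ∑ j, R j * b j x - ν * c x)
      + s * (ν * d - σ - (∑ i, L i * α i + ∑ j, R j * γ j)) := by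
    intro x s
    have := LinearMap.congr_fun hsum (x, s)
    simp only [Fintype.sum_sum_type, LinearMap.add_apply, LinearMap.sum_apply,
      LinearMap.smul_apply, Fintype.sum_bool, A, Sum.elim_inl, Sum.elim_inr, smul_eq_mul] at this
    have t1 : ∑ i, l (Sum.inl i) * (if p i then (a i).comp π₁ - α i • π₂ else 0 :
        V × ℝ →ₗ[ℝ] ℝ) (x, s) = ∑ i, L i * a i x - s * ∑ i, L i * α i := by
      rw [Finset.mul_sum, ← Finset.sum_sub_distrib]
      refine Finset.sum_congr rfl fun i _ => ?_
      by_cases hi : p i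
      · simp [hL, hi, π₁, π₂]; ring
      · simp [hL, hi]
    have t2 : ∑ j, l (Sum.inr (Sum.inl j)) * ((b j).comp π₁ - γ j • π₂ : V × ℝ →ₗ[ℝ] ℝ) (x, s)
        + ∑ j, l (Sum.inr (Sum.inr (Sum.inl j))) *
          (γ j • π₂ - (b j).comp π₁ : V × ℝ →ₗ[ℝ] ℝ) (x, s)
        = ∑ j, R j * b j x - s * ∑ j, R j * γ j := by
      rw [Finset.mul_sum, ← Finset.sum_sub_distrib, ← Finset.sum_add_distrib]
      refine Finset.sum_congr rfl fun j _ => ?_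
      simp [hR, π₁, π₂]; ring
    rw [t1] at this
    simp only [if_true, Bool.false_eq_true, if_false] at this
    have t3 : (d • π₂ - c.comp π₁ : V × ℝ →ₗ[ℝ] ℝ) (x, s) = d * s - c x := by simp [π₁, π₂]
    have t4 : (-π₂ : V × ℝ →ₗ[ℝ] ℝ) (x, s) = -s := by simp [π₂]
    have t5 : π₂ (x, s) = s := rfl
    rw [t3, t4, t5] at this
    linarith
  have k1 : ∀ h, ∑ i, L i * a i h + ∑ j, R j * b j h = ν * c h := fun h => by
    have := key h 0; linarith
  -- Strict because the coefficient of `s` in the Farkas identity is `1`. With `ν = 0` this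
  -- contradicts `hreg`; with `ν > 0`, division by `ν` contradicts `hdual`.
  have k2 : ∑ i, L i * α i + ∑ j, R j * γ j < ν * d := by
    have := key 0 1
    simp only [map_zero, mul_zero, Finset.sum_const_zero] at this
    linarith
  rcases hν.eq_or_lt with h0 | hpos
  · have := hreg L R hL0 hLp (fun h => by rw [k1, ← h0, zero_mul])
    rw [← h0] at k2; linarith
  · have := hdual (fun i => ν⁻¹ * L i) (fun j => ν⁻¹ * R j)
      (fun i => mul_nonneg (inv_pos.2 hpos).le (hL0 i)) (fun i hi => by simp [hLp i hi])
      (fun h => by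
        simp only [mul_assoc, ← Finset.mul_sum]
        rw [← mul_add, k1, inv_mul_cancel_left₀ hpos.ne'])
    simp only [mul_assoc, ← Finset.mul_sum] at this
    rw [← mul_add, le_inv_mul_iff₀ hpos] at this
    linarith

/-! ### Second-order expansions and partial derivatives. -/

section Calculus

variable {E : Type*} [NormedAddCommGroup E] [NormedSpace ℝ E]

/-- Second-order Taylor expansion of a `C²` function. -/
theorem ContDiff.taylor_two_isLittleO {g : E → ℝ} (hg : ContDiff ℝ 2 g) (z : E) :
    (fun v => g (z + v) - g z - fderiv ℝ g z v - 2⁻¹ * fderiv ℝ (fderiv ℝ g) z v v)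
      =o[𝓝 0] fun v => ‖v‖ ^ 2 := by
  have hd : Differentiable ℝ g := hg.differentiable (by norm_num)
  have hd2 : DifferentiableAt ℝ (fderiv ℝ g) z :=
    ((hg.fderiv_right (m := 1) (by norm_num)).differentiable (by norm_num)) z
  have hsymm : IsSymmSndFDerivAt ℝ g z := hg.contDiffAt.isSymmSndFDerivAt (by simp)
  set B := fderiv ℝ (fderiv ℝ g) z with hB
  -- By symmetry of the second derivative, the remainder has as derivative the first-order remainder
  -- of `fderiv ℝ g`, which is `o(‖v‖)`. The mean value inequality on the ball of radius `‖v‖` then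
  -- gives `o(‖v‖²)`.
  have hR : ∀ v, HasFDerivAt (fun v => g (z + v) - g z - fderiv ℝ g z v - 2⁻¹ * B v v)
      (fderiv ℝ g (z + v) - fderiv ℝ g z - B v) v := by
    intro v
    have h1 : HasFDerivAt (fun v => g (z + v)) (fderiv ℝ g (z + v)) v :=
      (hd (z + v)).hasFDerivAt.comp v ((hasFDerivAt_id v).const_add z)
    have h2 : HasFDerivAt (fun v => B v v) (B v + B.flip v) v :=
      (B.hasFDerivAt (x := v)).clm_apply (hasFDerivAt_id v)
    have h3 := ((h1.sub_const (g z)).fun_sub (fderiv ℝ g z).hasFDerivAt).fun_sub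
      (h2.const_mul 2⁻¹)
    refine h3.congr_fderiv ?_
    ext w
    have : B w v = B v w := hsymm w v
    simp [this]
    ring
  rw [Asymptotics.isLittleO_iff]
  intro ε hε
  have hlo := (hasFDerivAt_iff_isLittleO_nhds_zero.1 hd2.hasFDerivAt).def hε
  obtain ⟨r, hr, hball⟩ := Metric.eventually_nhds_iff_ball.1 hlo
  filter_upwards [Metric.ball_mem_nhds (0 : E) hr] with v hv
  have hv' : ‖v‖ < r := by simpa using hv
  have := (convex_closedBall (0 : E) ‖v‖).norm_image_sub_le_of_norm_hasFDerivWithin_le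
    (C := ε * ‖v‖) (fun x _ => (hR x).hasFDerivWithinAt) (fun x hx => by
      have hx' : ‖x‖ ≤ ‖v‖ := by simpa using hx
      exact (hball x (by simpa using hx'.trans_lt hv')).trans
        (mul_le_mul_of_nonneg_left hx' hε.le))
    (x := 0) (y := v) (by simp) (by simp)
  simpa [pow_two, mul_assoc] using this

/-- The directions may vary with the index, so that the expansion applies along maximizers, whose
path is unknown. The first-order term must keep `w k`, since an error in it would be divided by `s
k`; the quadratic term may pass to the limit. -/
theorem ContDiff.tendsto_div_pow_two {g : E → ℝ} (hg : ContDiff ℝ 2 g) (z : E) {ι : Type*}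
    {l : Filter ι} {s : ι → ℝ} {w : ι → E} {w₀ : E} (hs : Tendsto s l (𝓝[>] 0))
    (hw : Tendsto w l (𝓝 w₀)) :
    Tendsto (fun k => (g (z + s k • w k) - g z - s k * fderiv ℝ g z (w k)) / (s k ^ 2 / 2)) l
      (𝓝 (fderiv ℝ (fderiv ℝ g) z w₀ w₀)) := by
  obtain ⟨hs0, hspos⟩ := tendsto_nhdsWithin_iff.1 hs
  have hv : Tendsto (fun k => s k • w k) l (𝓝 0) := by simpa using hs0.smul hw
  have h1 := (hg.taylor_two_isLittleO z).comp_tendsto hv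
  have h2 : (fun k => ‖s k • w k‖ ^ 2) =O[l] fun k => s k ^ 2 := by
    have hb : (fun k => w k) =O[l] fun _ => (1 : ℝ) := hw.isBigO_one ℝ
    have := ((Asymptotics.isBigO_refl s l).smul hb).norm_left.pow 2
    simpa using this
  have h3 := (h1.trans_isBigO h2).tendsto_div_nhds_zero
  have h4 : Tendsto (fun k => fderiv ℝ (fderiv ℝ g) z (w k) (w k)) l
      (𝓝 (fderiv ℝ (fderiv ℝ g) z w₀ w₀)) := by
    have hc : Continuous fun v => fderiv ℝ (fderiv ℝ g) z v v := by fun_prop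
    exact (hc.tendsto w₀).comp hw
  have h5 := (h3.const_mul 2).add h4
  rw [mul_zero, zero_add] at h5
  refine h5.congr' ?_
  filter_upwards [hspos] with k hk
  have hk' : s k ≠ 0 := ne_of_gt hk
  simp only [Function.comp_apply, map_smul, smul_apply, smul_eq_mul]
  field_simp
  ring

theorem HasFDerivAt.tendsto_div {g : E → ℝ} {g' : E →L[ℝ] ℝ} {z : E} (hg : HasFDerivAt g g' z)
    {ι : Type*} {l : Filter ι} {s : ι → ℝ} {w : ι → E} {w₀ : E} (hs : Tendsto s l (𝓝[>] 0))
    (hw : Tendsto w l (𝓝 w₀)) :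
    Tendsto (fun k => (g (z + s k • w k) - g z) / s k) l (𝓝 (g' w₀)) := by
  obtain ⟨hs0, hspos⟩ := tendsto_nhdsWithin_iff.1 hs
  have hv : Tendsto (fun k => s k • w k) l (𝓝 0) := by simpa using hs0.smul hw
  have h1 := (hasFDerivAt_iff_isLittleO_nhds_zero.1 hg).comp_tendsto hv
  have h2 : (fun k => s k • w k) =O[l] s := by
    have hb : (fun k => w k) =O[l] fun _ => (1 : ℝ) := hw.isBigO_one ℝ
    simpa using (Asymptotics.isBigO_refl s l).smul hb
  have h3 := (h1.trans_isBigO h2).tendsto_div_nhds_zero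
  have h4 : Tendsto (fun k => g' (w k)) l (𝓝 (g' w₀)) := (g'.continuous.tendsto w₀).comp hw
  have h5 := h3.add h4
  rw [zero_add] at h5
  refine h5.congr' ?_
  filter_upwards [hspos] with k hk
  have hk' : s k ≠ 0 := ne_of_gt hk
  simp only [Function.comp_apply, map_smul, smul_eq_mul]
  field_simp
  ring

/-- Second-order expansion of a `C²` function along a parabola. -/
theorem ContDiff.tendsto_parabola {g : E → ℝ} (hg : ContDiff ℝ 2 g) (z d e : E) :
    Tendsto (fun t : ℝ => (g (z + t • d + (t ^ 2 / 2) • e) - g z - t * fderiv ℝ g z d)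
      / (t ^ 2 / 2)) (𝓝[>] 0)
      (𝓝 (fderiv ℝ g z e + fderiv ℝ (fderiv ℝ g) z d d)) := by
  -- The parabola is a ray with the moving direction `d + (t/2) e`; the drift of that direction
  -- accounts for the term `fderiv ℝ g z e`.
  have hw : Tendsto (fun t : ℝ => d + (t / 2) • e) (𝓝[>] 0) (𝓝 d) := by
    have : Continuous fun t : ℝ => d + (t / 2) • e := by fun_prop
    simpa using (this.tendsto 0).mono_left nhdsWithin_le_nhds
  have h1 := (hg.tendsto_div_pow_two z tendsto_id hw).const_add (fderiv ℝ g z e)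
  refine h1.congr' ?_
  filter_upwards [self_mem_nhdsWithin] with t ht
  have ht' : t ≠ 0 := ne_of_gt ht
  have : z + t • d + (t ^ 2 / 2) • e = z + t • (d + (t / 2) • e) := by
    rw [smul_add, smul_smul, add_assoc]; congr 3; ring
  rw [this]
  simp only [id, map_add, map_smul, smul_eq_mul]
  field_simp
  ring

variable {F : Type*} [NormedAddCommGroup F] [NormedSpace ℝ F]

theorem fderiv_partial_snd {G : Type*} [NormedAddCommGroup G] [NormedSpace ℝ G] {g : E × F → G}
    {x : E} {y : F} (hg : DifferentiableAt ℝ g (x, y)) :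
    fderiv ℝ (fun y => g (x, y)) y = (fderiv ℝ g (x, y)).comp (ContinuousLinearMap.inr ℝ E F) :=
  (hg.hasFDerivAt.comp y (hasFDerivAt_prodMk_right x y)).fderiv

theorem fderiv_partial_fst {G : Type*} [NormedAddCommGroup G] [NormedSpace ℝ G] {g : E × F → G}
    {x : E} {y : F} (hg : DifferentiableAt ℝ g (x, y)) :
    fderiv ℝ (fun x => g (x, y)) x = (fderiv ℝ g (x, y)).comp (ContinuousLinearMap.inl ℝ E F) :=
  (hg.hasFDerivAt.comp x (hasFDerivAt_prodMk_left x y)).fderiv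

theorem fderiv_fderiv_partial_snd {g : E × F → ℝ} (hg : ContDiff ℝ 2 g) (x : E) (y h k : F) :
    fderiv ℝ (fderiv ℝ (fun y => g (x, y))) y h k
      = fderiv ℝ (fderiv ℝ g) (x, y) (0, h) (0, k) := by
  have hd : Differentiable ℝ g := hg.differentiable (by norm_num)
  have hd2 : Differentiable ℝ (fderiv ℝ g) :=
    (hg.fderiv_right (m := 1) (by norm_num)).differentiable (by norm_num)
  have h1 : fderiv ℝ (fun y => g (x, y))
      = fun y => (fderiv ℝ g (x, y)).comp (ContinuousLinearMap.inr ℝ E F) :=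
    funext fun y => fderiv_partial_snd (hd _)
  have h2 : HasFDerivAt (fun y => fderiv ℝ g (x, y)) _ y :=
    (hd2 (x, y)).hasFDerivAt.comp y (hasFDerivAt_prodMk_right x y)
  rw [h1, (h2.clm_comp (hasFDerivAt_const _ y)).fderiv]
  simp

end Calculus

/-! ### Derivatives of the Lagrangian. -/

namespace MinimaxData

variable {n m p₁ p₂ q₁ q₂ : ℕ} {P : MinimaxData n m p₁ p₂ q₁ q₂}

theorem IsC2.Lmax (hP : P.IsC2) (β : (Fin q₁ → ℝ) × (Fin q₂ → ℝ)) : ContDiff ℝ 2 (P.Lmax β) := by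
  unfold MinimaxData.Lmax
  refine hP.1.sub (ContDiff.add (ContDiff.sum fun i _ => ?_) (ContDiff.sum fun j _ => ?_))
  · exact contDiff_const.mul (hP.2.2.2.1 i)
  · exact contDiff_const.mul (hP.2.2.2.2 j)

theorem IsC2.fderiv_Lmax (hP : P.IsC2) (β : (Fin q₁ → ℝ) × (Fin q₂ → ℝ)) (z : Vec n × Vec m) :
    fderiv ℝ (P.Lmax β) z = fderiv ℝ P.f z -
      ((∑ i, β.1 i • fderiv ℝ (P.innerIneq i) z) + ∑ j, β.2 j • fderiv ℝ (P.innerEq j) z) := by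
  unfold MinimaxData.Lmax
  refine HasFDerivAt.fderiv (HasFDerivAt.fun_sub ?_ (HasFDerivAt.fun_add
    (HasFDerivAt.fun_sum fun i _ => HasFDerivAt.const_mul ?_ _)
    (HasFDerivAt.fun_sum fun j _ => HasFDerivAt.const_mul ?_ _)))
  · exact (hP.1.differentiable (by norm_num) z).hasFDerivAt
  · exact ((hP.2.2.2.1 i).differentiable (by norm_num) z).hasFDerivAt
  · exact ((hP.2.2.2.2 j).differentiable (by norm_num) z).hasFDerivAt

theorem IsC2.fderiv_fderiv_Lmax (hP : P.IsC2) (β : (Fin q₁ → ℝ) × (Fin q₂ → ℝ))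
    (z : Vec n × Vec m) :
    fderiv ℝ (fderiv ℝ (P.Lmax β)) z = fderiv ℝ (fderiv ℝ P.f) z -
      ((∑ i, β.1 i • fderiv ℝ (fderiv ℝ (P.innerIneq i)) z)
        + ∑ j, β.2 j • fderiv ℝ (fderiv ℝ (P.innerEq j)) z) := by
  have hd : ∀ {g : Vec n × Vec m → ℝ}, ContDiff ℝ 2 g →
      HasFDerivAt (fderiv ℝ g) (fderiv ℝ (fderiv ℝ g) z) z := fun hg =>
    ((hg.fderiv_right (m := 1) (by norm_num)).differentiable (by norm_num) z).hasFDerivAt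
  rw [show fderiv ℝ (P.Lmax β) = _ from funext fun z => hP.fderiv_Lmax β z]
  exact HasFDerivAt.fderiv (HasFDerivAt.fun_sub (hd hP.1) (HasFDerivAt.fun_add
    (HasFDerivAt.fun_sum fun i _ => HasFDerivAt.fun_const_smul (hd (hP.2.2.2.1 i)) _)
    (HasFDerivAt.fun_sum fun j _ => HasFDerivAt.fun_const_smul (hd (hP.2.2.2.2 j)) _)))

end MinimaxData

/-! ### Robinson stability under MFCQ. -/

/-- Strict differentiability at one point makes the linear approximation in `y` uniform over nearby
parameters `x`. This keeps the constants of the stability estimate independent of `x`. -/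
theorem HasStrictFDerivAt.exists_ball_partial {E F G : Type*} [NormedAddCommGroup E]
    [NormedSpace ℝ E] [NormedAddCommGroup F] [NormedSpace ℝ F] [NormedAddCommGroup G]
    [NormedSpace ℝ G] {g : E × F → G} {g' : E × F →L[ℝ] G} {x₀ : E} {y₀ : F}
    (hg : HasStrictFDerivAt g g' (x₀, y₀)) {ε : ℝ} (hε : 0 < ε) :
    ∃ R > 0, ∀ x ∈ Metric.ball x₀ R, ∀ y ∈ Metric.ball y₀ R, ∀ y' ∈ Metric.ball y₀ R,
      ‖g (x, y) - g (x, y') - g' (0, y - y')‖ ≤ ε * ‖y - y'‖ := by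
  have h := hg.isLittleO.def hε
  rw [nhds_prod_eq] at h
  obtain ⟨t, ht, h⟩ := eventually_prod_self_iff'.1 h
  obtain ⟨R, hR, hRt⟩ := Metric.mem_nhds_iff.1 ht
  refine ⟨R, hR, fun x hx y hy y' hy' => ?_⟩
  have hm : ∀ y ∈ Metric.ball y₀ R, (x, y) ∈ t := fun y hy => hRt (by
    rw [← ball_prod_same]; exact ⟨hx, hy⟩)
  have := h (x, y) (hm y hy) (x, y') (hm y' hy')
  simpa [Prod.norm_def] using this

theorem exists_pos_forall_le {ι : Type*} [Finite ι] {p : ι → Prop} {a : ι → ℝ}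
    (h : ∀ i, p i → 0 < a i) : ∃ c > 0, ∀ i, p i → c ≤ a i := by
  have : ∀ᶠ c in 𝓝[>] (0 : ℝ), ∀ i, p i → c ≤ a i := by
    rw [eventually_all]
    intro i
    by_cases hi : p i
    · filter_upwards [Ioc_mem_nhdsGT (h i hi)] with c hc _ using hc.2
    · exact Eventually.of_forall fun c hc => absurd hc hi
  obtain ⟨c, hc, hpos⟩ := (this.and self_mem_nhdsWithin).exists
  exact ⟨c, hpos, hc⟩

namespace MinimaxData

variable {n m p₁ p₂ q₁ q₂ : ℕ} {P : MinimaxData n m p₁ p₂ q₁ q₂} {xb : Vec n} {yb : Vec m}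

theorem IsC2.differentiable_innerIneq (hP : P.IsC2) (i : Fin q₁) :
    Differentiable ℝ (P.innerIneq i) := (hP.2.2.2.1 i).differentiable (by norm_num)

theorem IsC2.differentiable_innerEq (hP : P.IsC2) (j : Fin q₂) :
    Differentiable ℝ (P.innerEq j) := (hP.2.2.2.2 j).differentiable (by norm_num)

/-- MFCQ in terms of the total derivatives, in its dual form for the equality constraints. -/
theorem MFCQ.total (hP : P.IsC2) (hM : P.MFCQ xb yb) :
    (∀ r : Fin q₂ → ℝ, (∀ k, ∑ j, r j * fderiv ℝ (P.innerEq j) (xb, yb) (0, k) = 0) → r = 0) ∧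
    ∃ w : Vec m, (∀ j, fderiv ℝ (P.innerEq j) (xb, yb) (0, w) = 0) ∧
      ∀ i, P.innerIneq i (xb, yb) = 0 → fderiv ℝ (P.innerIneq i) (xb, yb) (0, w) < 0 := by
  obtain ⟨hli, w, hw1, hw2⟩ := hM
  refine ⟨fun r hr => ?_, w, fun j => ?_, fun i hi => ?_⟩
  · refine funext fun j => (Fintype.linearIndependent_iff.1 hli) r ?_ j
    ext k
    refine Eq.trans ?_ (hr k)
    simp [fderiv_partial_snd (hP.differentiable_innerEq _ _)]
  · rw [← hw1 j, fderiv_partial_snd (hP.differentiable_innerEq _ _)]; simp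
  · have := hw2 i hi
    rw [fderiv_partial_snd (hP.differentiable_innerIneq _ _)] at this
    simpa using this

/-- Independence of the equality gradients makes their Jacobian surjective: in the linear program
without inequalities and with zero objective, the only dual feasible point is `r = 0`. -/
theorem MFCQ.exists_innerEq (hP : P.IsC2) (hM : P.MFCQ xb yb) (γ : Fin q₂ → ℝ) :
    ∃ k : Vec m, ∀ j, fderiv ℝ (P.innerEq j) (xb, yb) (0, k) = γ j := by
  obtain ⟨h0, -⟩ := hM.total hP
  obtain ⟨k, -, hk, -⟩ := exists_le_of_forall_dual (V := Vec m) (ι := Empty) (fun _ => True)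
    (fun e => e.elim) (fun e => e.elim)
    (fun j => ((fderiv ℝ (P.innerEq j) (xb, yb)).comp
      (ContinuousLinearMap.inr ℝ (Vec n) (Vec m))).toLinearMap) γ 0 0
    (fun l r _ _ h => by
      have : r = 0 := h0 r fun k => by simpa using h k
      simp [this])
    (fun l r _ _ h => by
      have : r = 0 := h0 r fun k => by simpa using h k
      simp [this])
  exact ⟨k, fun j => by simpa using hk j⟩

set_option maxHeartbeats 800000 in
/-- Robinson stability of the inner constraint system. -/
theorem MFCQ.robinson (hP : P.IsC2) (hy : yb ∈ P.Y xb) (hM : P.MFCQ xb yb) :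
    ∃ κ > 0, ∃ r > 0, ∀ x ∈ Metric.ball xb r, ∀ y ∈ Metric.ball yb r, ∀ ρ, 0 ≤ ρ → ρ ≤ r →
      (∀ i, P.innerIneq i (x, y) ≤ ρ) → (∀ j, |P.innerEq j (x, y)| ≤ ρ) →
      ∃ y' ∈ P.Y x, ‖y' - y‖ ≤ κ * ρ := by
  -- Two moves: a step `τ • w` creates slack in the active inequalities while disturbing the
  -- equalities only by the linearization error; then a quantitative open mapping argument solves
  -- the equalities near `y + τ • w`, spending part of that slack.
  obtain ⟨-, w, hw2, hw1⟩ := hM.total hP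
  set D₁ : Vec n × Vec m →L[ℝ] (Fin q₁ → ℝ) :=
    ContinuousLinearMap.pi fun i => fderiv ℝ (P.innerIneq i) (xb, yb) with hD₁
  set D₂ : Vec n × Vec m →L[ℝ] (Fin q₂ → ℝ) :=
    ContinuousLinearMap.pi fun j => fderiv ℝ (P.innerEq j) (xb, yb) with hD₂
  have hs₁ : HasStrictFDerivAt (fun z i => P.innerIneq i z) D₁ (xb, yb) :=
    hasStrictFDerivAt_pi.2 fun i =>
      (hP.2.2.2.1 i).contDiffAt.hasStrictFDerivAt (by norm_num)
  have hs₂ : HasStrictFDerivAt (fun z j => P.innerEq j z) D₂ (xb, yb) :=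
    hasStrictFDerivAt_pi.2 fun j =>
      (hP.2.2.2.2 j).contDiffAt.hasStrictFDerivAt (by norm_num)
  set A : Vec m →L[ℝ] (Fin q₂ → ℝ) := D₂.comp (ContinuousLinearMap.inr ℝ (Vec n) (Vec m)) with hA
  have hAsurj : A.range = ⊤ := LinearMap.range_eq_top.2 fun γ => by
    obtain ⟨k, hk⟩ := hM.exists_innerEq hP γ
    exact ⟨k, funext fun j => by simpa [hA, hD₂] using hk j⟩
  set N := A.nonlinearRightInverseOfSurjective hAsurj
  have hν : 0 < (N.nnnorm : ℝ) := A.nonlinearRightInverseOfSurjective_nnnorm_pos hAsurj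
  set ν : ℝ := (N.nnnorm : ℝ) with hν_def
  obtain ⟨c, hc, hcw⟩ := exists_pos_forall_le (p := fun i => P.innerIneq i (xb, yb) = 0)
    (a := fun i => -fderiv ℝ (P.innerIneq i) (xb, yb) (0, w)) (fun i hi => by
      have := hw1 i hi; linarith)
  set W := ‖w‖
  have hW : 0 ≤ W := norm_nonneg _
  set L := ‖D₁‖
  have hL : 0 ≤ L := norm_nonneg _
  set κ₀ := 2 * ν with hκ₀
  have hκ₀pos : 0 < κ₀ := by positivity
  set B := (L + 1) * κ₀ with hB
  have hBpos : 0 < B := by positivity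
  -- The bound `ν⁻¹ / 2` preserves at least half of the surjectivity rate of `A`; the last bound
  -- lets linearization errors consume at most half of the slack.
  obtain ⟨ε, hε, hε1, hεν, hεc⟩ : ∃ ε > 0, ε ≤ 1 ∧ ε ≤ ν⁻¹ / 2 ∧ ε * (W * (B + 1)) ≤ c / 2 := by
    refine ⟨min (min 1 (ν⁻¹ / 2)) (c / 2 / (W * (B + 1) + 1)), by positivity,
      (min_le_left _ _).trans (min_le_left _ _), (min_le_left _ _).trans (min_le_right _ _), ?_⟩
    have hpos : 0 < W * (B + 1) + 1 := by positivity
    calc _ ≤ c / 2 / (W * (B + 1) + 1) * (W * (B + 1) + 1) := by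
          refine mul_le_mul (min_le_right _ _) (by linarith) (by positivity) (by positivity)
      _ = c / 2 := div_mul_cancel₀ _ hpos.ne'
  obtain ⟨R₁, hR₁, hg₁⟩ := hs₁.exists_ball_partial hε
  obtain ⟨R₂, hR₂, hg₂⟩ := hs₂.exists_ball_partial hε
  have hin : ∀ᶠ z in 𝓝 (xb, yb), ∀ i, P.innerIneq i (xb, yb) ≠ 0 → P.innerIneq i z < 0 := by
    rw [eventually_all]
    intro i
    by_cases hi : P.innerIneq i (xb, yb) = 0
    · exact Eventually.of_forall fun z hz => absurd hi hz
    · have hlt : P.innerIneq i (xb, yb) < 0 := lt_of_le_of_ne (hy.1 i) hi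
      filter_upwards [(hP.differentiable_innerIneq i).continuous.continuousAt.eventually_lt
        continuousAt_const hlt] with z hz _ using hz
  obtain ⟨R₃, hR₃, hg₃⟩ := Metric.eventually_nhds_iff_ball.1 hin
  set R := min R₁ (min R₂ R₃)
  have hR : 0 < R := lt_min hR₁ (lt_min hR₂ hR₃)
  -- The slack is `τ c = 2 (1 + B) ρ`. The half left after linearization errors covers the initial
  -- violation `ρ` and the amount `B ρ` due to solving the equalities.
  set M := 2 * (1 + B) / c with hMdef
  have hMpos : 0 < M := by positivity
  set κ := M * W + κ₀ * (1 + M * W) with hκ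
  have hκpos : 0 < κ := by positivity
  -- This radius `r` satisfies `r + κ r = R / 2`, so every point constructed below stays in the ball
  -- of radius `R`.
  refine ⟨κ, hκpos, R / (2 * (κ + 1)), by positivity, fun x hx y hy' ρ hρ hρr h₁ h₂ => ?_⟩
  set r := R / (2 * (κ + 1)) with hr
  have hrR : r + κ * r < R := by
    have : r + κ * r = R / 2 := by rw [hr]; field_simp; ring
    rw [this]; linarith
  have hκρ : κ * ρ ≤ κ * r := mul_le_mul_of_nonneg_left hρr hκpos.le
  set τ := M * ρ with hτ
  have hτ0 : 0 ≤ τ := by positivity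
  set η := ρ + ε * (τ * W) with hη
  have hη0 : 0 ≤ η := by positivity
  have hητ : η ≤ ρ + τ * W := by
    have : ε * (τ * W) ≤ 1 * (τ * W) := mul_le_mul_of_nonneg_right hε1 (by positivity)
    linarith
  have hκsum : τ * W + κ₀ * η ≤ κ * ρ := by
    have : κ₀ * η ≤ κ₀ * (ρ + τ * W) := mul_le_mul_of_nonneg_left hητ hκ₀pos.le
    calc _ ≤ τ * W + κ₀ * (ρ + τ * W) := by linarith
      _ = κ * ρ := by rw [hκ, hτ]; ring
  have hyr : ‖y - yb‖ < r := by simpa [dist_eq_norm] using hy'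
  have hball : ∀ y', ‖y' - y‖ ≤ κ * ρ → y' ∈ Metric.ball yb R := fun y' h => by
    rw [mem_ball_iff_norm]
    calc ‖y' - yb‖ ≤ ‖y' - y‖ + ‖y - yb‖ := norm_sub_le_norm_sub_add_norm_sub _ _ _
      _ < R := by linarith
  have hxR : x ∈ Metric.ball xb R := Metric.ball_subset_ball (by nlinarith) hx
  have hR1 : R ≤ R₁ := min_le_left _ _
  have hR2 : R ≤ R₂ := (min_le_right _ _).trans (min_le_left _ _)
  have hR3 : R ≤ R₃ := (min_le_right _ _).trans (min_le_right _ _)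
  set y₁ := y + τ • w with hy₁
  have hτw : ‖τ • w‖ = τ * W := by rw [norm_smul, Real.norm_of_nonneg hτ0]
  have hyR : y ∈ Metric.ball yb R := hball y (by simpa using by positivity)
  have hcb : Metric.closedBall y₁ (κ₀ * η) ⊆ Metric.ball yb R := fun y' h => hball y' (by
    rw [mem_closedBall_iff_norm] at h
    calc ‖y' - y‖ ≤ ‖y' - y₁‖ + ‖y₁ - y‖ := norm_sub_le_norm_sub_add_norm_sub _ _ _
      _ ≤ κ₀ * η + τ * W := by
        gcongr
        rw [hy₁, add_sub_cancel_left, hτw]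
      _ ≤ κ * ρ := by linarith)
  have hy₁R : y₁ ∈ Metric.ball yb R := hcb (Metric.mem_closedBall_self (by positivity))
  have happ : ApproximatesLinearOn (fun y j => P.innerEq j (x, y)) A (Metric.ball yb R)
      ⟨ε, hε.le⟩ := fun a ha b hb =>
    hg₂ x (Metric.ball_subset_ball hR2 hxR) a (Metric.ball_subset_ball hR2 ha) b
      (Metric.ball_subset_ball hR2 hb)
  have hsurj := happ.surjOn_closedBall_of_nonlinearRightInverse N
    (by positivity : 0 ≤ κ₀ * η) hcb
  have hy₁val : ‖fun j => P.innerEq j (x, y₁)‖ ≤ η := by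
    have h3 := happ y₁ hy₁R y hyR
    have hA0 : A (y₁ - y) = 0 := by
      rw [hy₁, add_sub_cancel_left, map_smul]
      have : A w = 0 := funext fun j => by simpa [hA, hD₂] using hw2 j
      rw [this, smul_zero]
    rw [hA0, sub_zero, hy₁, add_sub_cancel_left, hτw] at h3
    have h4 : ‖fun j => P.innerEq j (x, y)‖ ≤ ρ := (pi_norm_le_iff_of_nonneg hρ).2 h₂
    calc _ = ‖((fun j => P.innerEq j (x, y₁)) - fun j => P.innerEq j (x, y))
          + fun j => P.innerEq j (x, y)‖ := by rw [sub_add_cancel]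
      _ ≤ ε * (τ * W) + ρ := (norm_add_le _ _).trans (add_le_add h3 h4)
      _ = η := by rw [hη]; ring
  obtain ⟨y', hy'mem, hy'0⟩ := hsurj (a := 0) (by
    rw [mem_closedBall_iff_norm, zero_sub, norm_neg]
    refine hy₁val.trans ?_
    have : (ν⁻¹ / 2) * (κ₀ * η) = η := by rw [hκ₀]; field_simp
    calc η = (ν⁻¹ / 2) * (κ₀ * η) := this.symm
      _ ≤ (ν⁻¹ - ε) * (κ₀ * η) :=
        mul_le_mul_of_nonneg_right (by linarith) (by positivity))
  have hy'R := hcb hy'mem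
  rw [mem_closedBall_iff_norm] at hy'mem
  have hy'y : ‖y' - y‖ ≤ κ₀ * η + τ * W := by
    calc ‖y' - y‖ ≤ ‖y' - y₁‖ + ‖y₁ - y‖ := norm_sub_le_norm_sub_add_norm_sub _ _ _
      _ ≤ κ₀ * η + τ * W := by
        gcongr
        rw [hy₁, add_sub_cancel_left, hτw]
  refine ⟨y', ⟨fun i => ?_, fun j => congrFun hy'0 j⟩, by linarith⟩
  by_cases hi : P.innerIneq i (xb, yb) = 0
  · have h3 := hg₁ x (Metric.ball_subset_ball hR1 hxR) y' (Metric.ball_subset_ball hR1 hy'R) y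
      (Metric.ball_subset_ball hR1 hyR)
    have h4 := (norm_le_pi_norm _ i).trans h3
    simp only [Pi.sub_apply, Real.norm_eq_abs] at h4
    have h5 := (abs_le.1 h4).2
    have h6 : D₁ (0, y' - y) i = τ * fderiv ℝ (P.innerIneq i) (xb, yb) (0, w)
        + D₁ (0, y' - y₁) i := by
      have : ((0 : Vec n), y' - y) = τ • (0, w) + (0, y' - y₁) := by
        rw [hy₁]
        refine Prod.ext (by simp) ?_
        change y' - y = τ • w + (y' - (y + τ • w))
        abel
      rw [this, map_add, map_smul]
      simp [hD₁]
    have h7 : D₁ (0, y' - y₁) i ≤ L * (κ₀ * η) := by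
      refine (Real.le_norm_self _).trans ((norm_le_pi_norm _ i).trans ?_)
      refine (D₁.le_opNorm _).trans (mul_le_mul_of_nonneg_left ?_ hL)
      simpa [Prod.norm_def] using hy'mem
    have h8 := hcw i hi
    have h9 := h₁ i
    have h10 : ε * ‖y' - y‖ ≤ κ₀ * η + ε * (τ * W) := by
      calc ε * ‖y' - y‖ ≤ ε * (κ₀ * η + τ * W) := mul_le_mul_of_nonneg_left hy'y hε.le
        _ ≤ 1 * (κ₀ * η) + ε * (τ * W) := by
          rw [mul_add]
          gcongr
        _ = _ := by ring
    have h11 : τ * fderiv ℝ (P.innerIneq i) (xb, yb) (0, w) ≤ -(τ * c) := by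
      have := mul_le_mul_of_nonneg_left h8 hτ0
      linarith
    have h12 : τ * c = 2 * (1 + B) * ρ := by rw [hτ, hMdef]; field_simp
    have h13 : τ * (ε * (W * (B + 1))) ≤ τ * (c / 2) := mul_le_mul_of_nonneg_left hεc hτ0
    have h14 : L * (κ₀ * η) + κ₀ * η = B * ρ + τ * (ε * (W * B)) := by rw [hB, hη]; ring
    have h15 : τ * (ε * (W * (B + 1))) = τ * (ε * (W * B)) + ε * (τ * W) := by ring
    linarith
  · refine (hg₃ (x, y') ?_ i hi).le
    rw [← ball_prod_same]
    exact ⟨Metric.ball_subset_ball hR3 hxR, Metric.ball_subset_ball hR3 hy'R⟩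

end MinimaxData

/-! ### Consequences of stability: corrected curves, Aubin property, Lipschitz value function. -/

namespace MinimaxData

variable {n m p₁ p₂ q₁ q₂ : ℕ} {P : MinimaxData n m p₁ p₂ q₁ q₂} {xb : Vec n} {yb : Vec m}

/-- A curve that satisfies the constraints up to `o(σ)` can be corrected by `o(σ)` to a feasible
curve. -/
theorem MFCQ.exists_correction (hP : P.IsC2) (hy : yb ∈ P.Y xb) (hM : P.MFCQ xb yb)
    {ι : Type*} {l : Filter ι} {x : ι → Vec n} {y : ι → Vec m} {σ : ι → ℝ}
    (hx : Tendsto x l (𝓝 xb)) (hyt : Tendsto y l (𝓝 yb)) (hσ : Tendsto σ l (𝓝[>] 0))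
    (hI : ∀ i, ∀ ε > 0, ∀ᶠ t in l, P.innerIneq i (x t, y t) ≤ ε * σ t)
    (hE : ∀ j, ∀ ε > 0, ∀ᶠ t in l, |P.innerEq j (x t, y t)| ≤ ε * σ t) :
    ∃ y' : ι → Vec m, (∀ᶠ t in l, y' t ∈ P.Y (x t)) ∧
      Tendsto (fun t => (σ t)⁻¹ • (y' t - y t)) l (𝓝 0) := by
  classical
  obtain ⟨κ, hκ, r, hr, H⟩ := hM.robinson hP hy
  obtain ⟨hσ0, hσpos⟩ := tendsto_nhdsWithin_iff.1 hσ
  -- The constraint residual. It is `o(σ)` by `hI` and `hE`, and the Robinson correction is at most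
  -- `κ` times it.
  set ρ : ι → ℝ := fun t => ‖fun i => max (P.innerIneq i (x t, y t)) 0‖
    + ‖fun j => P.innerEq j (x t, y t)‖ with hρ
  have hρ0 : ∀ t, 0 ≤ ρ t := fun t => by positivity
  have hρε : ∀ ε > 0, ∀ᶠ t in l, ρ t ≤ ε * σ t := by
    intro ε hε
    filter_upwards [eventually_all.2 fun i => hI i (ε / 2) (by positivity),
      eventually_all.2 fun j => hE j (ε / 2) (by positivity), hσpos] with t h1 h2 h3
    have h3' : 0 < σ t := h3
    have e1 : ‖fun i => max (P.innerIneq i (x t, y t)) 0‖ ≤ ε / 2 * σ t := by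
      refine (pi_norm_le_iff_of_nonneg (by positivity)).2 fun i => ?_
      rw [Real.norm_of_nonneg (le_max_right _ _)]
      exact max_le (h1 i) (by positivity)
    have e2 : ‖fun j => P.innerEq j (x t, y t)‖ ≤ ε / 2 * σ t :=
      (pi_norm_le_iff_of_nonneg (by positivity)).2 h2
    calc ρ t ≤ ε / 2 * σ t + ε / 2 * σ t := add_le_add e1 e2
      _ = ε * σ t := by ring
  have hρr : ∀ᶠ t in l, ρ t ≤ r := by
    filter_upwards [hρε 1 one_pos, hσ0.eventually_lt_const hr] with t h1 h2
    linarith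
  have hex : ∀ᶠ t in l, ∃ y' ∈ P.Y (x t), ‖y' - y t‖ ≤ κ * ρ t := by
    filter_upwards [hρr, hx (Metric.ball_mem_nhds xb hr), hyt (Metric.ball_mem_nhds yb hr)]
      with t h1 h2 h3
    refine H _ h2 _ h3 _ (hρ0 t) h1 (fun i => ?_) fun j => ?_
    · calc P.innerIneq i (x t, y t) ≤ max (P.innerIneq i (x t, y t)) 0 := le_max_left _ _
        _ ≤ ‖fun i => max (P.innerIneq i (x t, y t)) 0‖ :=
          (Real.le_norm_self _).trans
            (norm_le_pi_norm (fun i => max (P.innerIneq i (x t, y t)) 0) i)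
        _ ≤ ρ t := le_add_of_nonneg_right (norm_nonneg _)
    · exact (norm_le_pi_norm (fun j => P.innerEq j (x t, y t)) j).trans
        (le_add_of_nonneg_left (norm_nonneg _))
  refine ⟨fun t => if h : ∃ y' ∈ P.Y (x t), ‖y' - y t‖ ≤ κ * ρ t then h.choose else y t, ?_, ?_⟩
  · filter_upwards [hex] with t ht
    rw [dif_pos ht]
    exact ht.choose_spec.1
  · rw [Metric.tendsto_nhds]
    intro ε hε
    filter_upwards [hex, hρε (ε / (2 * κ)) (by positivity), hσpos] with t ht h2 h3
    have h3' : 0 < σ t := h3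
    rw [dif_pos ht, dist_zero_right, norm_smul, norm_inv, Real.norm_of_nonneg h3'.le,
      inv_mul_lt_iff₀ h3']
    calc _ ≤ κ * ρ t := ht.choose_spec.2
      _ ≤ κ * (ε / (2 * κ) * σ t) := mul_le_mul_of_nonneg_left h2 hκ.le
      _ = σ t * ε / 2 := by field_simp
      _ < σ t * ε := by have := mul_pos h3' hε; linarith

/-- Under MFCQ the linearization cone is contained in the contingent cone. -/
theorem MFCQ.linY_zero_subset (hP : P.IsC2) (hy : yb ∈ P.Y xb) (hM : P.MFCQ xb yb) {h : Vec m}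
    (hh : h ∈ P.linY xb yb 0) : h ∈ posTangentConeAt (P.Y xb) yb := by
  have hid : Tendsto (fun t : ℝ => t) (𝓝[>] 0) (𝓝[>] 0) := tendsto_id
  have hyt : Tendsto (fun t : ℝ => yb + t • h) (𝓝[>] 0) (𝓝 yb) := by
    have : Continuous fun t : ℝ => yb + t • h := by fun_prop
    simpa using (this.tendsto 0).mono_left nhdsWithin_le_nhds
  have hz : ∀ t : ℝ, (xb, yb + t • h) = (xb, yb) + t • ((0 : Vec n), h) := fun t => by
    ext <;> simp
  obtain ⟨y', hy', hlim⟩ := hM.exists_correction hP hy tendsto_const_nhds hyt hid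
    (fun i ε hε => by
      have h1 := (hP.differentiable_innerIneq i (xb, yb)).hasFDerivAt.tendsto_div hid
        (tendsto_const_nhds (x := ((0 : Vec n), h)))
      by_cases hi : P.innerIneq i (xb, yb) = 0
      · filter_upwards [h1.eventually_lt_const ((hh.1 i hi).trans_lt hε), self_mem_nhdsWithin]
          with t ht h0
        have h0' : (0 : ℝ) < t := h0
        rw [hi, sub_zero, div_lt_iff₀ h0'] at ht
        rw [hz]; exact ht.le
      · have hlt : P.innerIneq i (xb, yb) < 0 := lt_of_le_of_ne (hy.1 i) hi
        have hc : Tendsto (fun t : ℝ => P.innerIneq i (xb, yb + t • h)) (𝓝[>] 0)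
            (𝓝 (P.innerIneq i (xb, yb))) :=
          ((hP.differentiable_innerIneq i).continuous.tendsto _).comp
            (tendsto_const_nhds.prodMk_nhds hyt)
        filter_upwards [hc.eventually_lt_const hlt, self_mem_nhdsWithin] with t ht h0
        have h0' : (0 : ℝ) < t := h0
        exact ht.le.trans (by positivity))
    (fun j ε hε => by
      have h1 := (hP.differentiable_innerEq j (xb, yb)).hasFDerivAt.tendsto_div hid
        (tendsto_const_nhds (x := ((0 : Vec n), h)))
      rw [hh.2 j] at h1
      filter_upwards [h1.abs.eventually_lt_const (by simpa using hε), self_mem_nhdsWithin]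
        with t ht h0
      have h0' : (0 : ℝ) < t := h0
      rw [hy.2 j, sub_zero, abs_div, abs_of_pos h0', div_lt_iff₀ h0'] at ht
      rw [hz]; exact ht.le)
  have hlim2 : Tendsto (fun t : ℝ => t⁻¹ • (y' t - yb)) (𝓝[>] 0) (𝓝 h) := by
    have h1 := hlim.add_const h
    rw [zero_add] at h1
    refine h1.congr' ?_
    filter_upwards [self_mem_nhdsWithin] with t ht
    have ht' : t ≠ 0 := ne_of_gt ht
    have : y' t - yb = (y' t - (yb + t • h)) + t • h := by abel
    rw [this, smul_add, smul_smul, inv_mul_cancel₀ ht', one_smul]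
  have h0 : Tendsto (fun t : ℝ => y' t - yb) (𝓝[>] 0) (𝓝 0) := by
    have h1 := (tendsto_nhdsWithin_iff.1 hid).1.smul hlim2
    rw [zero_smul] at h1
    refine h1.congr' ?_
    filter_upwards [self_mem_nhdsWithin] with t ht
    have ht' : t ≠ 0 := ne_of_gt ht
    rw [smul_smul, mul_inv_cancel₀ ht', one_smul]
  refine mem_tangentConeAt_of_seq (𝓝[>] (0 : ℝ)) (fun t => Real.toNNReal t⁻¹)
    (fun t => y' t - yb) h0 ?_ ?_
  · filter_upwards [hy'] with t ht
    simpa using ht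
  · refine hlim2.congr' ?_
    filter_upwards [self_mem_nhdsWithin] with t ht
    have ht' : (0 : ℝ) < t := ht
    rw [NNReal.smul_def, Real.coe_toNNReal _ (inv_pos.2 ht').le]

/-- Lipschitz-like (Aubin) property of the feasible set mapping. -/
theorem MFCQ.aubin (hP : P.IsC2) (hy : yb ∈ P.Y xb) (hM : P.MFCQ xb yb) :
    ∃ κ > 0, ∃ r > 0, ∀ x ∈ Metric.ball xb r, ∀ x' ∈ Metric.ball xb r, ∀ y ∈ Metric.ball yb r,
      y ∈ P.Y x → ∃ y' ∈ P.Y x', ‖y' - y‖ ≤ κ * ‖x' - x‖ := by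
  obtain ⟨κ, hκ, r, hr, H⟩ := hM.robinson hP hy
  have hd₁ : ContDiff ℝ 1 (fun z i => P.innerIneq i z) :=
    contDiff_pi.2 fun i => (hP.2.2.2.1 i).of_le (by norm_num)
  have hd₂ : ContDiff ℝ 1 (fun z j => P.innerEq j z) :=
    contDiff_pi.2 fun j => (hP.2.2.2.2 j).of_le (by norm_num)
  obtain ⟨K₁, t₁, ht₁, hK₁⟩ := (hd₁.contDiffAt (x := (xb, yb))).exists_lipschitzOnWith
  obtain ⟨K₂, t₂, ht₂, hK₂⟩ := (hd₂.contDiffAt (x := (xb, yb))).exists_lipschitzOnWith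
  obtain ⟨R, hR, hRt⟩ := Metric.mem_nhds_iff.1 (inter_mem ht₁ ht₂)
  set K : ℝ := K₁ + K₂ + 1
  have hK : 0 < K := by positivity
  have hK₁' : (K₁ : ℝ) ≤ K := by simp only [K]; linarith [K₂.coe_nonneg]
  have hK₂' : (K₂ : ℝ) ≤ K := by simp only [K]; linarith [K₁.coe_nonneg]
  refine ⟨κ * K, by positivity, min (min r R) (r / (2 * K)), by positivity,
    fun x hx x' hx' y hyr hyx => ?_⟩
  have hrr : min (min r R) (r / (2 * K)) ≤ r := (min_le_left _ _).trans (min_le_left _ _)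
  have hrR : min (min r R) (r / (2 * K)) ≤ R := (min_le_left _ _).trans (min_le_right _ _)
  have hrK : min (min r R) (r / (2 * K)) ≤ r / (2 * K) := min_le_right _ _
  have hmem : ∀ x ∈ Metric.ball xb (min (min r R) (r / (2 * K))), (x, y) ∈ t₁ ∩ t₂ :=
    fun x hx => hRt (by
      rw [← ball_prod_same]
      exact ⟨Metric.ball_subset_ball hrR hx, Metric.ball_subset_ball hrR hyr⟩)
  have hdist : dist (x', y) (x, y) = ‖x' - x‖ := by
    simp [dist_eq_norm]
  have hsmall : K * ‖x' - x‖ ≤ r := by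
    have : ‖x' - x‖ ≤ r / (2 * K) + r / (2 * K) := by
      rw [← dist_eq_norm]
      refine (dist_triangle_right _ _ xb).trans (add_le_add ?_ ?_)
      · exact (Metric.mem_ball.1 hx').le.trans hrK
      · exact (Metric.mem_ball.1 hx).le.trans hrK
    calc K * ‖x' - x‖ ≤ K * (r / (2 * K) + r / (2 * K)) := mul_le_mul_of_nonneg_left this hK.le
      _ = r := by field_simp; norm_num
  have e₁ := hK₁.dist_le_mul _ (hmem x' hx').1 _ (hmem x hx).1
  have e₂ := hK₂.dist_le_mul _ (hmem x' hx').2 _ (hmem x hx).2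
  rw [hdist] at e₁ e₂
  -- The point `y` is feasible for `x`, so its residual at `x'` is at most `K ‖x' - x‖` by Lipschitz
  -- continuity of the constraints.
  obtain ⟨y', hy', hyy'⟩ := H x' (Metric.ball_subset_ball hrr hx') y
    (Metric.ball_subset_ball hrr hyr) (K * ‖x' - x‖) (by positivity) hsmall (fun i => by
      have h1 := (dist_le_pi_dist _ _ i).trans e₁
      rw [Real.dist_eq] at h1
      have h2 := (abs_le.1 h1).2
      have h3 := hyx.1 i
      have := mul_le_mul_of_nonneg_right hK₁' (norm_nonneg (x' - x))
      linarith) (fun j => by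
      have h1 := (dist_le_pi_dist _ _ j).trans e₂
      rw [Real.dist_eq] at h1
      have h3 := hyx.2 j
      have := mul_le_mul_of_nonneg_right hK₂' (norm_nonneg (x' - x))
      simp only [h3, sub_zero] at h1
      linarith)
  exact ⟨y', hy', by rw [mul_assoc]; exact hyy'⟩

theorem IsC2.isCompact_localY (hP : P.IsC2) (δ : ℝ) (x : Vec n) :
    IsCompact (P.localY yb δ x) := by
  refine (isCompact_closedBall yb δ).inter_left ?_
  have : P.Y x = (⋂ i, {y | P.innerIneq i (x, y) ≤ 0}) ∩ ⋂ j, {y | P.innerEq j (x, y) = 0} := by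
    ext y; simp [Y]
  rw [this]
  refine IsClosed.inter (isClosed_iInter fun i => ?_) (isClosed_iInter fun j => ?_)
  · exact isClosed_le ((hP.differentiable_innerIneq i).continuous.comp
      (by fun_prop : Continuous fun y : Vec m => (x, y))) continuous_const
  · exact isClosed_eq ((hP.differentiable_innerEq j).continuous.comp
      (by fun_prop : Continuous fun y : Vec m => (x, y))) continuous_const

theorem isGreatest_of_mem_S {δ : ℝ} {x : Vec n} {y : Vec m} (hy : y ∈ P.S yb δ x) :
    IsGreatest ((fun y => P.f (x, y)) '' P.localY yb δ x) (P.f (x, y)) :=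
  ⟨⟨y, hy.1, rfl⟩, by rintro _ ⟨y', hy', rfl⟩; exact hy.2 y' hy'⟩

theorem V_eq_of_mem_S {δ : ℝ} {x : Vec n} {y : Vec m} (hy : y ∈ P.S yb δ x) :
    P.V yb δ x = P.f (x, y) := (isGreatest_of_mem_S hy).csSup_eq

theorem IsC2.nonempty_S (hP : P.IsC2) {δ : ℝ} {x : Vec n} (h : (P.localY yb δ x).Nonempty) :
    (P.S yb δ x).Nonempty := by
  obtain ⟨y, hy, hmax⟩ := (hP.isCompact_localY δ x).exists_isMaxOn h
    (f := fun y => P.f (x, y)) (hP.1.continuous.comp (by fun_prop)).continuousOn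
  exact ⟨y, hy, fun y' hy' => hmax hy'⟩

theorem IsC2.le_V (hP : P.IsC2) {δ : ℝ} {x : Vec n} {y : Vec m} (hy : y ∈ P.localY yb δ x) :
    P.f (x, y) ≤ P.V yb δ x := by
  obtain ⟨y', hy'⟩ := hP.nonempty_S ⟨y, hy⟩
  rw [V_eq_of_mem_S hy']
  exact hy'.2 y hy

/-- The Aubin property moves `yb` to a point of `Y(x)` at distance at most `κ ‖x - xb‖`, which is
below `δ` for `x` near `xb`. -/
theorem MFCQ.eventually_nonempty_S (hP : P.IsC2) (hy : yb ∈ P.Y xb) (hM : P.MFCQ xb yb) {δ : ℝ}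
    (hδ : 0 < δ) : ∀ᶠ x in 𝓝 xb, (P.S yb δ x).Nonempty := by
  obtain ⟨κ, hκ, r, hr, H⟩ := hM.aubin hP hy
  filter_upwards [Metric.ball_mem_nhds xb hr,
    Metric.ball_mem_nhds xb (show 0 < δ / κ by positivity)] with x hx hx'
  obtain ⟨y', hy', hyy'⟩ := H xb (Metric.mem_ball_self hr) x hx yb (Metric.mem_ball_self hr) hy
  refine hP.nonempty_S ⟨y', hy', ?_⟩
  rw [mem_closedBall_iff_norm]
  rw [mem_ball_iff_norm, lt_div_iff₀ hκ] at hx'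
  linarith

/-- Maximizers converge to the unique maximizer at `xb`. -/
theorem MFCQ.eventually_S_subset (hP : P.IsC2) (hy : yb ∈ P.Y xb) (hM : P.MFCQ xb yb) {δ : ℝ}
    (hδ : 0 < δ) (hS : P.S yb δ xb = {yb}) {ε : ℝ} (hε : 0 < ε) :
    ∀ᶠ x in 𝓝 xb, ∀ y ∈ P.S yb δ x, ‖y - yb‖ < ε := by
  by_contra hcon
  rw [not_eventually] at hcon
  obtain ⟨x, hx, hxp⟩ := exists_seq_forall_of_frequently hcon
  push Not at hxp
  choose y hyS hyε using hxp
  obtain ⟨y₀, hy₀, φ, hφ, hlim⟩ := (isCompact_closedBall yb δ).tendsto_subseq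
    fun k => (hyS k).1.2
  have hxφ : Tendsto (x ∘ φ) atTop (𝓝 xb) := hx.comp hφ.tendsto_atTop
  have hpair : Tendsto (fun k => (x (φ k), y (φ k))) atTop (𝓝 (xb, y₀)) :=
    hxφ.prodMk_nhds hlim
  have hy₀Y : y₀ ∈ P.Y xb := by
    refine ⟨fun i => ?_, fun j => ?_⟩
    · exact le_of_tendsto (((hP.differentiable_innerIneq i).continuous.tendsto _).comp hpair)
        (Eventually.of_forall fun k => (hyS (φ k)).1.1.1 i)
    · refine tendsto_nhds_unique (((hP.differentiable_innerEq j).continuous.tendsto _).comp hpair)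
        (tendsto_const_nhds.congr fun k => ?_)
      exact ((hyS (φ k)).1.1.2 j).symm
  obtain ⟨κ, hκ, r, hr, H⟩ := hM.aubin hP hy
  -- The point `yb` is a limit of points admissible for `x (φ k)`, which the maximizers beat. In the
  -- limit `y₀` is no worse than `yb`, and uniqueness gives `y₀ = yb`.
  have hle : P.f (xb, yb) ≤ P.f (xb, y₀) := by
    have hcf := hP.1.continuous
    have hex : ∀ᶠ k in atTop, ∃ y' ∈ P.Y (x (φ k)), ‖y' - yb‖ ≤ κ * ‖x (φ k) - xb‖ := by
      filter_upwards [hxφ (Metric.ball_mem_nhds xb hr)] with k hk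
      exact H xb (Metric.mem_ball_self hr) _ hk yb (Metric.mem_ball_self hr) hy
    classical
    set y' : ℕ → Vec m := fun k =>
      if h : ∃ y' ∈ P.Y (x (φ k)), ‖y' - yb‖ ≤ κ * ‖x (φ k) - xb‖ then h.choose else yb
      with hy'def
    have hy'n : ∀ k, ‖y' k - yb‖ ≤ κ * ‖x (φ k) - xb‖ := fun k => by
      simp only [hy'def]
      split_ifs with h
      · exact h.choose_spec.2
      · simp; positivity
    have hxn : Tendsto (fun k => κ * ‖x (φ k) - xb‖) atTop (𝓝 0) := by
      have := (tendsto_iff_norm_sub_tendsto_zero.1 hxφ).const_mul κ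
      simpa using this
    have hy'lim : Tendsto y' atTop (𝓝 yb) :=
      tendsto_iff_norm_sub_tendsto_zero.2 (squeeze_zero (fun _ => norm_nonneg _) hy'n hxn)
    refine le_of_tendsto_of_tendsto ((hcf.tendsto _).comp (hxφ.prodMk_nhds hy'lim))
      ((hcf.tendsto _).comp hpair) ?_
    filter_upwards [hex, hxn.eventually_lt_const hδ] with k hk hkδ
    refine (hyS (φ k)).2 _ ⟨?_, ?_⟩
    · simp only [hy'def]
      rw [dif_pos hk]
      exact hk.choose_spec.1
    · rw [mem_closedBall_iff_norm]
      exact (hy'n k).trans hkδ.le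
  have hybS : yb ∈ P.S yb δ xb := by rw [hS]; rfl
  have : y₀ ∈ P.S yb δ xb := ⟨⟨hy₀Y, hy₀⟩, fun y' hy' => (hybS.2 y' hy').trans hle⟩
  rw [hS] at this
  have hy₀eq : y₀ = yb := this
  have h1 : Tendsto (fun k => ‖y (φ k) - yb‖) atTop (𝓝 0) := by
    have := tendsto_iff_norm_sub_tendsto_zero.1 hlim
    rwa [hy₀eq] at this
  exact absurd (ge_of_tendsto h1 (Eventually.of_forall fun k => hyε (φ k))) (not_le.2 hε)

/-- A maximizer at `x` moves to a feasible point at `x'` over a distance `O(‖x' - x‖)`. Closeness of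
maximizers to `yb` keeps the moved point inside the `δ`-ball, so it competes at `x'`. -/
theorem MFCQ.lipschitz_V (hP : P.IsC2) (hy : yb ∈ P.Y xb) (hM : P.MFCQ xb yb) {δ : ℝ}
    (hδ : 0 < δ) (hS : P.S yb δ xb = {yb}) :
    ∃ U ∈ 𝓝 xb,
      (∀ x ∈ U, IsGreatest ((fun y => P.f (x, y)) '' P.localY yb δ x) (P.V yb δ x)) ∧
      ∃ K : NNReal, LipschitzOnWith K (P.V yb δ) U := by
  obtain ⟨κ, hκ, r, hr, H⟩ := hM.aubin hP hy
  obtain ⟨K, t, ht, hK⟩ :=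
    ((hP.1.of_le (by norm_num : (1 : WithTop ℕ∞) ≤ 2)).contDiffAt
      (x := (xb, yb))).exists_lipschitzOnWith
  obtain ⟨R, hR, hRt⟩ := Metric.mem_nhds_iff.1 ht
  -- Halved so that a maximizer within `r₀` of `yb`, displaced by at most `r₀`, remains in all the
  -- neighbourhoods.
  set r₀ := min (min r R) δ / 2 with hr₀
  have hr₀pos : 0 < r₀ := by positivity
  have hr₀r : r₀ + r₀ ≤ min (min r R) δ := by rw [hr₀]; linarith
  have hrr : min (min r R) δ ≤ r := (min_le_left _ _).trans (min_le_left _ _)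
  have hrR : min (min r R) δ ≤ R := (min_le_left _ _).trans (min_le_right _ _)
  have hrδ : min (min r R) δ ≤ δ := min_le_right _ _
  have hU : ∀ᶠ x in 𝓝 xb, (P.S yb δ x).Nonempty ∧ (∀ y ∈ P.S yb δ x, ‖y - yb‖ < r₀) ∧
      x ∈ Metric.ball xb r₀ ∧ x ∈ Metric.ball xb (r₀ / (2 * κ)) := by
    filter_upwards [hM.eventually_nonempty_S hP hy hδ, hM.eventually_S_subset hP hy hδ hS hr₀pos,
      Metric.ball_mem_nhds xb hr₀pos, Metric.ball_mem_nhds xb (show 0 < r₀ / (2 * κ) by positivity)]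
      with x h1 h2 h3 h4 using ⟨h1, h2, h3, h4⟩
  refine ⟨_, hU, fun x hx => ?_, K * (1 + κ.toNNReal), LipschitzOnWith.of_le_add_mul _ ?_⟩
  · obtain ⟨y, hyS⟩ := hx.1
    rw [V_eq_of_mem_S hyS]
    exact isGreatest_of_mem_S hyS
  · intro x hx x' hx'
    obtain ⟨y, hyS⟩ := hx.1
    have hyb := hx.2.1 y hyS
    obtain ⟨y', hy', hyy'⟩ := H x (Metric.ball_subset_ball (by linarith) hx.2.2.1) x'
      (Metric.ball_subset_ball (by linarith) hx'.2.2.1) y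
      (by rw [mem_ball_iff_norm]; linarith) hyS.1.1
    have hxx' : κ * ‖x' - x‖ ≤ r₀ := by
      have : ‖x' - x‖ ≤ r₀ / (2 * κ) + r₀ / (2 * κ) := by
        rw [← dist_eq_norm]
        exact (dist_triangle_right _ _ xb).trans
          (add_le_add (Metric.mem_ball.1 hx'.2.2.2).le (Metric.mem_ball.1 hx.2.2.2).le)
      calc _ ≤ κ * (r₀ / (2 * κ) + r₀ / (2 * κ)) := mul_le_mul_of_nonneg_left this hκ.le
        _ = r₀ := by field_simp; norm_num
    have hy'b : ‖y' - yb‖ < r₀ + r₀ :=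
      (norm_sub_le_norm_sub_add_norm_sub y' y yb).trans_lt (by linarith)
    have hV : P.f (x', y') ≤ P.V yb δ x' :=
      hP.le_V ⟨hy', by rw [mem_closedBall_iff_norm]; linarith⟩
    rw [V_eq_of_mem_S hyS]
    have hm : (x, y) ∈ t := hRt (by
      rw [← ball_prod_same]
      exact ⟨Metric.ball_subset_ball (by linarith) hx.2.2.1, by rw [mem_ball_iff_norm]; linarith⟩)
    have hm' : (x', y') ∈ t := hRt (by
      rw [← ball_prod_same]
      exact ⟨Metric.ball_subset_ball (by linarith) hx'.2.2.1, by rw [mem_ball_iff_norm]; linarith⟩)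
    have hL := hK.dist_le_mul _ hm _ hm'
    have hd : dist (x, y) (x', y') ≤ (1 + κ) * dist x x' := by
      rw [Prod.dist_eq]
      refine max_le ?_ ?_
      · simp only; nlinarith [dist_nonneg (x := x) (y := x')]
      · simp only
        rw [dist_comm, dist_eq_norm, dist_comm x x', dist_eq_norm]
        nlinarith [norm_nonneg (x' - x)]
    have hL2 : dist (P.f (x, y)) (P.f (x', y')) ≤ K * ((1 + κ) * dist x x') :=
      hL.trans (mul_le_mul_of_nonneg_left hd K.coe_nonneg)
    rw [Real.dist_eq] at hL2
    have := (abs_le.1 hL2).2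
    simp only [NNReal.coe_mul, NNReal.coe_add, NNReal.coe_one, Real.coe_toNNReal _ hκ.le]
    rw [mul_assoc]
    linarith

end MinimaxData

/-! ### Multipliers and duality for the linearized inner problems. -/

theorem ContinuousLinearMap.map_prodMk_eq_add {E F G : Type*} [NormedAddCommGroup E]
    [NormedSpace ℝ E] [NormedAddCommGroup F] [NormedSpace ℝ F] [NormedAddCommGroup G]
    [NormedSpace ℝ G] (D : E × F →L[ℝ] G) (u : E) (h : F) : D (u, h) = D (u, 0) + D (0, h) := by
  rw [← map_add]; simp

namespace MinimaxData

variable {n m p₁ p₂ q₁ q₂ : ℕ} {P : MinimaxData n m p₁ p₂ q₁ q₂} {xb : Vec n} {yb : Vec m}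

theorem IsC2.fderiv_Lmax_apply (hP : P.IsC2) (β : (Fin q₁ → ℝ) × (Fin q₂ → ℝ))
    (z d : Vec n × Vec m) :
    fderiv ℝ (P.Lmax β) z d = fderiv ℝ P.f z d -
      ((∑ i, β.1 i * fderiv ℝ (P.innerIneq i) z d) + ∑ j, β.2 j * fderiv ℝ (P.innerEq j) z d) := by
  simp [hP.fderiv_Lmax]

theorem IsC2.hessL_eq (hP : P.IsC2) (u : Vec n) (h : Vec m) (β : (Fin q₁ → ℝ) × (Fin q₂ → ℝ)) :
    P.hessL xb yb u h β = fderiv ℝ (fderiv ℝ P.f) (xb, yb) (u, h) (u, h) -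
      ((∑ i, β.1 i * fderiv ℝ (fderiv ℝ (P.innerIneq i)) (xb, yb) (u, h) (u, h))
        + ∑ j, β.2 j * fderiv ℝ (fderiv ℝ (P.innerEq j)) (xb, yb) (u, h) (u, h)) := by
  simp [hessL, hP.fderiv_fderiv_Lmax]

theorem IsC2.continuous_hessL (hP : P.IsC2) (u : Vec n) :
    Continuous fun a : Vec m × ((Fin q₁ → ℝ) × (Fin q₂ → ℝ)) => P.hessL xb yb u a.1 a.2 := by
  simp only [hP.hessL_eq]
  fun_prop

theorem IsC2.mem_multipliers_iff (hP : P.IsC2) {β : (Fin q₁ → ℝ) × (Fin q₂ → ℝ)} :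
    β ∈ P.multipliers xb yb ↔ (∀ i, 0 ≤ β.1 i) ∧ (∀ i, β.1 i * P.innerIneq i (xb, yb) = 0) ∧
      ∀ k, fderiv ℝ (P.Lmax β) (xb, yb) (0, k) = 0 := by
  unfold multipliers
  rw [Set.mem_ofPred_eq, fderiv_partial_snd ((hP.Lmax β).differentiable (by norm_num) _)]
  refine and_congr_right fun _ => and_congr_right fun _ => ⟨fun h k => ?_, fun h => ?_⟩
  · simpa using DFunLike.congr_fun h k
  · ext k; simpa using h k

theorem IsC2.mem_multipliers2_iff (hP : P.IsC2) {u : Vec n}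
    {β : (Fin q₁ → ℝ) × (Fin q₂ → ℝ)} :
    β ∈ P.multipliers2 xb yb u ↔ β ∈ P.multipliers xb yb ∧ ∀ β' ∈ P.multipliers xb yb,
      fderiv ℝ (P.Lmax β) (xb, yb) (u, 0) ≤ fderiv ℝ (P.Lmax β') (xb, yb) (u, 0) := by
  unfold multipliers2
  simp only [Set.mem_ofPred_eq, fderiv_partial_fst ((hP.Lmax _).differentiable (by norm_num) _)]
  simp

/-- Under MFCQ the gradients are positively linearly independent. -/
theorem MFCQ.pos_linearIndependent (hP : P.IsC2) (hM : P.MFCQ xb yb) {l : Fin q₁ → ℝ}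
    {r : Fin q₂ → ℝ} (hl : ∀ i, 0 ≤ l i) (hl0 : ∀ i, P.innerIneq i (xb, yb) ≠ 0 → l i = 0)
    (hsum : ∀ k, ∑ i, l i * fderiv ℝ (P.innerIneq i) (xb, yb) (0, k)
      + ∑ j, r j * fderiv ℝ (P.innerEq j) (xb, yb) (0, k) = 0) : l = 0 ∧ r = 0 := by
  obtain ⟨h0, w, hw2, hw1⟩ := hM.total hP
  have hle : ∀ i ∈ Finset.univ, l i * fderiv ℝ (P.innerIneq i) (xb, yb) (0, w) ≤ 0 := by
    intro i _
    by_cases hi : P.innerIneq i (xb, yb) = 0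
    · exact mul_nonpos_of_nonneg_of_nonpos (hl i) (hw1 i hi).le
    · simp [hl0 i hi]
  have hw := hsum w
  simp only [hw2, mul_zero, Finset.sum_const_zero, add_zero] at hw
  have hl' : l = 0 := by
    funext i
    by_cases hi : P.innerIneq i (xb, yb) = 0
    · have := (Finset.sum_eq_zero_iff_of_nonpos hle).1 hw i (Finset.mem_univ i)
      exact (mul_eq_zero.1 this).resolve_right (hw1 i hi).ne
    · exact hl0 i hi
  exact ⟨hl', h0 r fun k => by simpa [hl'] using hsum k⟩

/-- Stationarity tested on the MFCQ direction `w` bounds the inequality multipliers by `B`. Tested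
on vectors `k j` dual to the equality gradients, it then isolates and bounds each equality
multiplier. -/
theorem MFCQ.isCompact_multipliers (hP : P.IsC2) (hM : P.MFCQ xb yb) :
    IsCompact (P.multipliers xb yb) := by
  obtain ⟨-, w, hw2, hw1⟩ := hM.total hP
  obtain ⟨c, hc, hcw⟩ := exists_pos_forall_le (p := fun i => P.innerIneq i (xb, yb) = 0)
    (a := fun i => -fderiv ℝ (P.innerIneq i) (xb, yb) (0, w)) (fun i hi => by
      have := hw1 i hi; linarith)
  classical
  choose k hk using fun j : Fin q₂ => hM.exists_innerEq hP (Pi.single j 1)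
  set B : ℝ := |fderiv ℝ P.f (xb, yb) (0, w)| / c
  set C : Fin q₂ → ℝ := fun j => |fderiv ℝ P.f (xb, yb) (0, k j)|
    + ∑ i, B * |fderiv ℝ (P.innerIneq i) (xb, yb) (0, k j)|
  have hset : P.multipliers xb yb = (⋂ i, {β | 0 ≤ β.1 i}) ∩
      ((⋂ i, {β | β.1 i * P.innerIneq i (xb, yb) = 0}) ∩
      ⋂ k, {β | fderiv ℝ (P.Lmax β) (xb, yb) (0, k) = 0}) := by
    ext β; simp [hP.mem_multipliers_iff]
  refine IsCompact.of_isClosed_subset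
    ((isCompact_univ_pi fun _ : Fin q₁ => isCompact_Icc (a := (0 : ℝ)) (b := B)).prod
      (isCompact_univ_pi fun j : Fin q₂ => isCompact_Icc (a := -C j) (b := C j))) ?_ ?_
  · rw [hset]
    refine (isClosed_iInter fun i => ?_).inter
      ((isClosed_iInter fun i => ?_).inter (isClosed_iInter fun k => ?_))
    · exact isClosed_le continuous_const (by fun_prop)
    · exact isClosed_eq (by fun_prop) continuous_const
    · simp only [hP.fderiv_Lmax_apply]
      exact isClosed_eq (by fun_prop) continuous_const
  · intro β hβ
    obtain ⟨hβ0, hβc, hβL⟩ := hP.mem_multipliers_iff.1 hβ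
    simp only [hP.fderiv_Lmax_apply] at hβL
    have h1 : ∀ i, β.1 i * c ≤ -(β.1 i * fderiv ℝ (P.innerIneq i) (xb, yb) (0, w)) := by
      intro i
      by_cases hi : P.innerIneq i (xb, yb) = 0
      · have := mul_le_mul_of_nonneg_left (hcw i hi) (hβ0 i)
        linarith
      · have : β.1 i = 0 := (mul_eq_zero.1 (hβc i)).resolve_right hi
        simp [this]
    have h2 : ∀ i, β.1 i ≤ B := by
      intro i
      rw [le_div_iff₀ hc]
      have h3 : ∑ i, β.1 i * c ≤ -∑ i, β.1 i * fderiv ℝ (P.innerIneq i) (xb, yb) (0, w) := by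
        rw [← Finset.sum_neg_distrib]; exact Finset.sum_le_sum fun i _ => h1 i
      have h4 := Finset.single_le_sum (f := fun i => β.1 i * c)
        (fun i _ => mul_nonneg (hβ0 i) hc.le) (Finset.mem_univ i)
      have h5 := hβL w
      simp only [hw2, mul_zero, Finset.sum_const_zero, add_zero] at h5
      have h6 := neg_abs_le (fderiv ℝ P.f (xb, yb) (0, w))
      linarith
    refine ⟨fun i _ => ⟨hβ0 i, h2 i⟩, fun j _ => ?_⟩
    have h5 := hβL (k j)
    simp only [hk, Pi.single_apply, mul_ite, mul_one, mul_zero, Finset.sum_ite_eq',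
      Finset.mem_univ, if_true] at h5
    refine abs_le.1 ?_
    have h7 : β.2 j = fderiv ℝ P.f (xb, yb) (0, k j)
        - ∑ i, β.1 i * fderiv ℝ (P.innerIneq i) (xb, yb) (0, k j) := by linarith
    rw [h7]
    refine (abs_sub _ _).trans (add_le_add le_rfl ?_)
    refine (Finset.abs_sum_le_sum_abs _ _).trans (Finset.sum_le_sum fun i _ => ?_)
    rw [abs_mul, abs_of_nonneg (hβ0 i)]
    exact mul_le_mul_of_nonneg_right (h2 i) (abs_nonneg _)

/-- The minimal value `v` of `∇ₓL(β)ᵀu` over the multipliers. -/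
theorem MFCQ.exists_dual_value (hP : P.IsC2) (hM : P.MFCQ xb yb)
    (hne : (P.multipliers xb yb).Nonempty) (u : Vec n) :
    ∃ v : ℝ, (∀ β ∈ P.multipliers xb yb, v ≤ fderiv ℝ (P.Lmax β) (xb, yb) (u, 0)) ∧
      (∀ β, β ∈ P.multipliers2 xb yb u ↔
        β ∈ P.multipliers xb yb ∧ fderiv ℝ (P.Lmax β) (xb, yb) (u, 0) = v) ∧
      IsCompact (P.multipliers2 xb yb u) ∧ (P.multipliers2 xb yb u).Nonempty := by
  have hcont : Continuous fun β : (Fin q₁ → ℝ) × (Fin q₂ → ℝ) =>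
      fderiv ℝ (P.Lmax β) (xb, yb) (u, 0) := by
    simp only [hP.fderiv_Lmax_apply]
    fun_prop
  have hcomp := hM.isCompact_multipliers hP
  obtain ⟨β₀, hβ₀, hmin⟩ := hcomp.exists_isMinOn hne hcont.continuousOn
  have hiff : ∀ β, β ∈ P.multipliers2 xb yb u ↔ β ∈ P.multipliers xb yb ∧
      fderiv ℝ (P.Lmax β) (xb, yb) (u, 0) = fderiv ℝ (P.Lmax β₀) (xb, yb) (u, 0) := by
    intro β
    rw [hP.mem_multipliers2_iff]
    refine and_congr_right fun hβ => ⟨fun h => le_antisymm (h β₀ hβ₀) (hmin hβ), fun h β' hβ' => ?_⟩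
    rw [h]; exact hmin hβ'
  refine ⟨fderiv ℝ (P.Lmax β₀) (xb, yb) (u, 0), fun β hβ => hmin hβ, hiff, ?_,
    ⟨β₀, (hiff β₀).2 ⟨hβ₀, rfl⟩⟩⟩
  have : P.multipliers2 xb yb u = P.multipliers xb yb ∩
      {β | fderiv ℝ (P.Lmax β) (xb, yb) (u, 0) = fderiv ℝ (P.Lmax β₀) (xb, yb) (u, 0)} :=
    Set.ext hiff
  rw [this]
  exact hcomp.inter_right (isClosed_eq hcont continuous_const)

/-- Weak duality for the linearized inner problem. -/
theorem IsC2.fderiv_f_le (hP : P.IsC2) {u : Vec n} {h : Vec m} (hh : h ∈ P.linY xb yb u)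
    {β : (Fin q₁ → ℝ) × (Fin q₂ → ℝ)} (hβ : β ∈ P.multipliers xb yb) :
    fderiv ℝ P.f (xb, yb) (u, h) ≤ fderiv ℝ (P.Lmax β) (xb, yb) (u, 0) := by
  obtain ⟨hβ0, hβc, hβL⟩ := hP.mem_multipliers_iff.1 hβ
  have h1 := (fderiv ℝ (P.Lmax β) (xb, yb)).map_prodMk_eq_add u h
  rw [hβL h, add_zero] at h1
  rw [← h1, hP.fderiv_Lmax_apply]
  have h2 : ∑ i, β.1 i * fderiv ℝ (P.innerIneq i) (xb, yb) (u, h) ≤ 0 := by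
    refine Finset.sum_nonpos fun i _ => ?_
    by_cases hi : P.innerIneq i (xb, yb) = 0
    · exact mul_nonpos_of_nonneg_of_nonpos (hβ0 i) (hh.1 i hi)
    · rw [(mul_eq_zero.1 (hβc i)).resolve_right hi, zero_mul]
  simp only [hh.2, mul_zero, Finset.sum_const_zero, add_zero]
  linarith

/-- Strong duality for the linearized inner problem. -/
theorem MFCQ.exists_linY_le (hP : P.IsC2) (hM : P.MFCQ xb yb) {u : Vec n} {v : ℝ}
    (hv : ∀ β ∈ P.multipliers xb yb, v ≤ fderiv ℝ (P.Lmax β) (xb, yb) (u, 0)) :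
    ∃ h ∈ P.linY xb yb u, v ≤ fderiv ℝ P.f (xb, yb) (u, h) := by
  -- Dual feasible pairs are multipliers, and positive linear independence leaves only zero in the
  -- homogeneous dual.
  obtain ⟨h, h1, h2, h3⟩ := exists_le_of_forall_dual (V := Vec m)
    (fun i => P.innerIneq i (xb, yb) = 0)
    (fun i => ((fderiv ℝ (P.innerIneq i) (xb, yb)).comp
      (ContinuousLinearMap.inr ℝ (Vec n) (Vec m))).toLinearMap)
    (fun i => -fderiv ℝ (P.innerIneq i) (xb, yb) (u, 0))
    (fun j => ((fderiv ℝ (P.innerEq j) (xb, yb)).comp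
      (ContinuousLinearMap.inr ℝ (Vec n) (Vec m))).toLinearMap)
    (fun j => -fderiv ℝ (P.innerEq j) (xb, yb) (u, 0))
    ((fderiv ℝ P.f (xb, yb)).comp (ContinuousLinearMap.inr ℝ (Vec n) (Vec m))).toLinearMap
    (v - fderiv ℝ P.f (xb, yb) (u, 0))
    (fun l r hl hl0 hsum => by
      obtain ⟨rfl, rfl⟩ := hM.pos_linearIndependent hP hl hl0 (fun k => by simpa using hsum k)
      simp)
    (fun l r hl hl0 hsum => by
      have hβ : (l, r) ∈ P.multipliers xb yb := by
        refine hP.mem_multipliers_iff.2 ⟨hl, fun i => ?_, fun k => ?_⟩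
        · by_cases hi : P.innerIneq i (xb, yb) = 0
          · simp [hi]
          · simp [hl0 i hi]
        · have := hsum k
          simp only [ContinuousLinearMap.coe_coe, ContinuousLinearMap.comp_apply,
            ContinuousLinearMap.inr_apply] at this
          rw [hP.fderiv_Lmax_apply]
          linarith
      have := hv _ hβ
      rw [hP.fderiv_Lmax_apply] at this
      simp only [mul_neg, Finset.sum_neg_distrib]
      linarith)
  simp only [ContinuousLinearMap.coe_coe, ContinuousLinearMap.comp_apply,
    ContinuousLinearMap.inr_apply] at h1 h2 h3
  refine ⟨h, ⟨fun i hi => ?_, fun j => ?_⟩, ?_⟩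
  · rw [ContinuousLinearMap.map_prodMk_eq_add]; linarith [h1 i hi]
  · rw [ContinuousLinearMap.map_prodMk_eq_add, h2 j]; ring
  · rw [ContinuousLinearMap.map_prodMk_eq_add]; linarith

/-- Without a duality gap the maximal value is `v`, so the argmax becomes a closed inequality that
is stable under limits. -/
theorem MFCQ.mem_linY2_iff (hP : P.IsC2) (hM : P.MFCQ xb yb) {u : Vec n} {v : ℝ}
    (hv : ∀ β ∈ P.multipliers xb yb, v ≤ fderiv ℝ (P.Lmax β) (xb, yb) (u, 0))
    (hv2 : ∃ β ∈ P.multipliers xb yb, fderiv ℝ (P.Lmax β) (xb, yb) (u, 0) = v) {h : Vec m} :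
    h ∈ P.linY2 xb yb u ↔ h ∈ P.linY xb yb u ∧ v ≤ fderiv ℝ P.f (xb, yb) (u, h) := by
  obtain ⟨β, hβ, hβv⟩ := hv2
  refine and_congr_right fun hh => ⟨fun H => ?_, fun H h' hh' => ?_⟩
  · obtain ⟨h', hh', hle⟩ := hM.exists_linY_le hP hv
    exact hle.trans (H h' hh')
  · exact ((hP.fderiv_f_le hh' hβ).trans hβv.le).trans H

/-- Strong duality for the second-order linearized inner problem. -/
theorem MFCQ.exists_second_order (hP : P.IsC2) (hM : P.MFCQ xb yb) {u : Vec n} {v : ℝ}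
    (hiff : ∀ β, β ∈ P.multipliers2 xb yb u ↔
        β ∈ P.multipliers xb yb ∧ fderiv ℝ (P.Lmax β) (xb, yb) (u, 0) = v)
    {h : Vec m} (hh : h ∈ P.linY xb yb u) (hhv : fderiv ℝ P.f (xb, yb) (u, h) = v) {q : ℝ}
    (hq : ∀ β ∈ P.multipliers2 xb yb u, q ≤ P.hessL xb yb u h β) :
    ∃ k : Vec m,
      (∀ i, P.innerIneq i (xb, yb) = 0 → fderiv ℝ (P.innerIneq i) (xb, yb) (u, h) = 0 →
        fderiv ℝ (P.innerIneq i) (xb, yb) (0, k)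
          + fderiv ℝ (fderiv ℝ (P.innerIneq i)) (xb, yb) (u, h) (u, h) ≤ 0) ∧
      (∀ j, fderiv ℝ (P.innerEq j) (xb, yb) (0, k)
          + fderiv ℝ (fderiv ℝ (P.innerEq j)) (xb, yb) (u, h) (u, h) = 0) ∧
      q ≤ fderiv ℝ P.f (xb, yb) (0, k) + fderiv ℝ (fderiv ℝ P.f) (xb, yb) (u, h) (u, h) := by
  obtain ⟨k, h1, h2, h3⟩ := exists_le_of_forall_dual (V := Vec m)
    -- Only constraints still active to first order along `(u, h)` are kept. Dual variables
    -- supported there are complementary to `h`, which places them in `multipliers2`.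
    (fun i => P.innerIneq i (xb, yb) = 0 ∧ fderiv ℝ (P.innerIneq i) (xb, yb) (u, h) = 0)
    (fun i => ((fderiv ℝ (P.innerIneq i) (xb, yb)).comp
      (ContinuousLinearMap.inr ℝ (Vec n) (Vec m))).toLinearMap)
    (fun i => -fderiv ℝ (fderiv ℝ (P.innerIneq i)) (xb, yb) (u, h) (u, h))
    (fun j => ((fderiv ℝ (P.innerEq j) (xb, yb)).comp
      (ContinuousLinearMap.inr ℝ (Vec n) (Vec m))).toLinearMap)
    (fun j => -fderiv ℝ (fderiv ℝ (P.innerEq j)) (xb, yb) (u, h) (u, h))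
    ((fderiv ℝ P.f (xb, yb)).comp (ContinuousLinearMap.inr ℝ (Vec n) (Vec m))).toLinearMap
    (q - fderiv ℝ (fderiv ℝ P.f) (xb, yb) (u, h) (u, h))
    (fun l r hl hl0 hsum => by
      obtain ⟨rfl, rfl⟩ := hM.pos_linearIndependent hP hl (fun i hi => hl0 i fun H => hi H.1)
        (fun k => by simpa using hsum k)
      simp)
    (fun l r hl hl0 hsum => by
      have hβ : (l, r) ∈ P.multipliers xb yb := by
        refine hP.mem_multipliers_iff.2 ⟨hl, fun i => ?_, fun k => ?_⟩
        · by_cases hi : P.innerIneq i (xb, yb) = 0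
          · simp [hi]
          · simp [hl0 i fun H => hi H.1]
        · have := hsum k
          simp only [ContinuousLinearMap.coe_coe, ContinuousLinearMap.comp_apply,
            ContinuousLinearMap.inr_apply] at this
          rw [hP.fderiv_Lmax_apply]
          linarith
      have hβ2 : (l, r) ∈ P.multipliers2 xb yb u := by
        refine (hiff _).2 ⟨hβ, ?_⟩
        have e1 := (fderiv ℝ (P.Lmax (l, r)) (xb, yb)).map_prodMk_eq_add u h
        rw [(hP.mem_multipliers_iff.1 hβ).2.2 h, add_zero] at e1
        rw [← e1, hP.fderiv_Lmax_apply, hhv]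
        have e2 : ∑ i, l i * fderiv ℝ (P.innerIneq i) (xb, yb) (u, h) = 0 := by
          refine Finset.sum_eq_zero fun i _ => ?_
          by_cases hi : P.innerIneq i (xb, yb) = 0 ∧
              fderiv ℝ (P.innerIneq i) (xb, yb) (u, h) = 0
          · rw [hi.2, mul_zero]
          · rw [hl0 i hi, zero_mul]
        simp [e2, hh.2]
      have := hq _ hβ2
      rw [hP.hessL_eq] at this
      simp only [mul_neg, Finset.sum_neg_distrib]
      linarith)
  simp only [ContinuousLinearMap.coe_coe, ContinuousLinearMap.comp_apply,
    ContinuousLinearMap.inr_apply] at h1 h2 h3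
  exact ⟨k, fun i hi hi' => by linarith [h1 i ⟨hi, hi'⟩], fun j => by rw [h2 j]; ring,
    by linarith⟩

end MinimaxData

/-! ### Second-order expansion of the value function. -/

namespace MinimaxData

variable {n m p₁ p₂ q₁ q₂ : ℕ} {P : MinimaxData n m p₁ p₂ q₁ q₂} {xb : Vec n} {yb : Vec m}

theorem hessL_smul (t : ℝ) (u : Vec n) (h : Vec m) (β : (Fin q₁ → ℝ) × (Fin q₂ → ℝ)) :
    P.hessL xb yb (t • u) (t • h) β = t ^ 2 * P.hessL xb yb u h β := by
  unfold hessL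
  rw [← Prod.smul_mk]
  simp only [map_smul, smul_apply, smul_eq_mul]
  ring

theorem IsC2.continuous_hessL_left (hP : P.IsC2) (β : (Fin q₁ → ℝ) × (Fin q₂ → ℝ)) :
    Continuous fun a : Vec n × Vec m => P.hessL xb yb a.1 a.2 β := by
  simp only [hP.hessL_eq]
  fun_prop

theorem continuous_fderiv_apply (g : Vec n × Vec m → ℝ) (z : Vec n × Vec m) :
    Continuous fun a : Vec n × Vec m => fderiv ℝ g z (a.1, a.2) := by fun_prop

/-- `SSOSC` excludes nonzero critical directions along which no Hessian of the Lagrangian is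
negative. -/
theorem SSOSC.eq_zero (hP : P.IsC2) (hy : yb ∈ P.Y xb) (hM : P.MFCQ xb yb) {u : Vec n}
    (hS : P.SSOSC xb yb u) {η : Vec m} (hη : η ∈ P.linY xb yb 0)
    (hf : 0 ≤ fderiv ℝ P.f (xb, yb) (0, η))
    (hL : ∀ β ∈ P.multipliers2 xb yb u, 0 ≤ P.hessL xb yb 0 η β) : η = 0 := by
  by_contra hne
  obtain ⟨β, hβ, hlt⟩ := hS.2 η ⟨hM.linY_zero_subset hP hy hη, by
    rw [fderiv_partial_snd (hP.1.differentiable (by norm_num) _)]; simpa using hf⟩ hne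
  rw [fderiv_fderiv_partial_snd (hP.Lmax β)] at hlt
  exact absurd (hL β hβ) (not_le.2 hlt)

theorem isClosed_linY (u : Vec n) : IsClosed (P.linY xb yb u) := by
  have : P.linY xb yb u = (⋂ i, ⋂ (_ : P.innerIneq i (xb, yb) = 0),
      {h | fderiv ℝ (P.innerIneq i) (xb, yb) (u, h) ≤ 0}) ∩
      ⋂ j, {h | fderiv ℝ (P.innerEq j) (xb, yb) (u, h) = 0} := by
    ext h; simp [linY]
  rw [this]
  exact (isClosed_iInter fun i => isClosed_iInter fun _ =>
    isClosed_le (by fun_prop) continuous_const).inter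
    (isClosed_iInter fun j => isClosed_eq (by fun_prop) continuous_const)

/-- Rescaling an unbounded sequence to unit length makes `u`, `v` and `c` disappear in the limit.
What remains is a unit critical direction with no negative Hessian value, which SSOSC excludes. -/
theorem SSOSC.isBounded_superlevel (hP : P.IsC2) (hy : yb ∈ P.Y xb) (hM : P.MFCQ xb yb)
    {u : Vec n} (hS : P.SSOSC xb yb u) (v c : ℝ) :
    Bornology.IsBounded {h | h ∈ P.linY xb yb u ∧ v ≤ fderiv ℝ P.f (xb, yb) (u, h) ∧
      ∀ β ∈ P.multipliers2 xb yb u, c ≤ P.hessL xb yb u h β} := by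
  rw [isBounded_iff_forall_norm_le]
  by_contra hcon
  push Not at hcon
  choose h hmem hnorm using fun k : ℕ => hcon (k + 1)
  have hpos : ∀ k, 0 < ‖h k‖ := fun k => by
    have := hnorm k
    have : (0 : ℝ) ≤ k := k.cast_nonneg
    linarith
  have hinf : Tendsto (fun k => ‖h k‖) atTop atTop :=
    tendsto_atTop_mono (fun k => by have := hnorm k; linarith)
      tendsto_natCast_atTop_atTop
  set s : ℕ → ℝ := fun k => ‖h k‖⁻¹ with hs
  have hspos : ∀ k, 0 < s k := fun k => inv_pos.2 (hpos k)
  have hs0 : Tendsto s atTop (𝓝 0) := tendsto_inv_atTop_zero.comp hinf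
  obtain ⟨η, hη, φ, hφ, hlim⟩ := (isCompact_sphere (0 : Vec m) 1).tendsto_subseq
    (x := fun k => s k • h k) (fun k => by
      rw [mem_sphere_zero_iff_norm, norm_smul, Real.norm_of_nonneg (hspos k).le, hs]
      exact inv_mul_cancel₀ (hpos k).ne')
  have hpair : Tendsto (fun k => (s (φ k) • u, s (φ k) • h (φ k))) atTop (𝓝 (0, η)) := by
    have := (hs0.comp hφ.tendsto_atTop).smul_const u
    rw [zero_smul] at this
    exact this.prodMk_nhds hlim
  have hlin : ∀ g : Vec n × Vec m → ℝ, Tendsto (fun k => s (φ k) *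
      fderiv ℝ g (xb, yb) (u, h (φ k))) atTop (𝓝 (fderiv ℝ g (xb, yb) (0, η))) := fun g => by
    refine (((continuous_fderiv_apply g (xb, yb)).tendsto _).comp hpair).congr fun k => ?_
    simp only [Function.comp_apply]
    rw [← Prod.smul_mk, map_smul, smul_eq_mul]
  have hη0 : η = 0 := by
    refine hS.eq_zero hP hy hM ⟨fun i hi => ?_, fun j => ?_⟩ ?_ fun β hβ => ?_
    · exact le_of_tendsto (hlin _) (Eventually.of_forall fun k =>
        mul_nonpos_of_nonneg_of_nonpos (hspos _).le ((hmem (φ k)).1.1 i hi))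
    · refine tendsto_nhds_unique (hlin _) (tendsto_const_nhds.congr fun k => ?_)
      rw [(hmem (φ k)).1.2 j, mul_zero]
    · have h1 := (hs0.comp hφ.tendsto_atTop).mul_const v
      rw [zero_mul] at h1
      exact le_of_tendsto_of_tendsto' h1 (hlin _) fun k =>
        mul_le_mul_of_nonneg_left (hmem (φ k)).2.1 (hspos _).le
    · have h1 := ((hs0.comp hφ.tendsto_atTop).pow 2).mul_const c
      rw [zero_pow two_ne_zero, zero_mul] at h1
      refine le_of_tendsto_of_tendsto' h1
        (((hP.continuous_hessL_left β).tendsto _).comp hpair) fun k => ?_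
      simp only [Function.comp_apply, hessL_smul]
      exact mul_le_mul_of_nonneg_left ((hmem (φ k)).2.2 β hβ) (by positivity)
  rw [hη0] at hη
  simp at hη

/-- The inner minimum and the outer maximum in the second-order bound are attained. -/
theorem SSOSC.exists_max_min (hP : P.IsC2) (hy : yb ∈ P.Y xb) (hM : P.MFCQ xb yb)
    {u : Vec n} (hS : P.SSOSC xb yb u) :
    ∃ q : Vec m → ℝ,
      (∀ h, IsLeast (P.hessL xb yb u h '' P.multipliers2 xb yb u) (q h)) ∧
      ∃ M : ℝ, IsGreatest (q '' P.linY2 xb yb u) M := by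
  obtain ⟨v, hv, hiff, hcomp, hne⟩ := hM.exists_dual_value hP hS.1 u
  obtain ⟨β₀, hβ₀⟩ := hne
  have hmem := fun h => hM.mem_linY2_iff hP (h := h) hv ⟨β₀, (hiff β₀).1 hβ₀⟩
  set q : Vec m → ℝ := fun h => sInf (P.hessL xb yb u h '' P.multipliers2 xb yb u) with hq
  have hqc : Continuous q := hcomp.continuous_sInf (hP.continuous_hessL u)
  have hleast : ∀ h, IsLeast (P.hessL xb yb u h '' P.multipliers2 xb yb u) (q h) := fun h =>
    (hcomp.image ((hP.continuous_hessL u).comp (by fun_prop : Continuous fun β :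
      (Fin q₁ → ℝ) × (Fin q₂ → ℝ) => (h, β)))).isLeast_sInf ⟨_, β₀, hβ₀, rfl⟩
  refine ⟨q, hleast, ?_⟩
  obtain ⟨h₀, hh₀⟩ := hM.exists_linY_le hP hv
  -- The set `linY2` may be unbounded, but its part where `q` is at least `q h₀` is compact, and the
  -- maximum can be sought there.
  set K : Set (Vec m) := {h | h ∈ P.linY xb yb u ∧ v ≤ fderiv ℝ P.f (xb, yb) (u, h) ∧
      q h₀ ≤ q h} with hK
  have hKclosed : IsClosed K := by
    have : K = P.linY xb yb u ∩ ({h | v ≤ fderiv ℝ P.f (xb, yb) (u, h)} ∩ {h | q h₀ ≤ q h}) := rfl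
    rw [this]
    exact (isClosed_linY u).inter ((isClosed_le continuous_const (by fun_prop)).inter
      (isClosed_le continuous_const hqc))
  have hKbdd : Bornology.IsBounded K :=
    (hS.isBounded_superlevel hP hy hM v (q h₀)).subset fun h hh =>
      ⟨hh.1, hh.2.1, fun β hβ => hh.2.2.trans ((hleast h).2 ⟨β, hβ, rfl⟩)⟩
  obtain ⟨h₁, hh₁, hmax⟩ := (Metric.isCompact_of_isClosed_isBounded hKclosed hKbdd).exists_isMaxOn
    ⟨h₀, hh₀.1, hh₀.2, le_rfl⟩ hqc.continuousOn
  refine ⟨q h₁, ⟨h₁, (hmem h₁).2 ⟨hh₁.1, hh₁.2.1⟩, rfl⟩, ?_⟩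
  rintro _ ⟨h, hh, rfl⟩
  rw [hmem] at hh
  by_cases hle : q h₀ ≤ q h
  · exact hmax ⟨hh.1, hh.2, hle⟩
  · exact (not_le.1 hle).le.trans hh₁.2.2

/-- Lower second-order estimate for the value function. -/
theorem MFCQ.eventually_lt_second_quotient (hP : P.IsC2) (hy : yb ∈ P.Y xb) (hM : P.MFCQ xb yb)
    {δ : ℝ} (hδ : 0 < δ) (hVb : P.V yb δ xb = P.f (xb, yb)) {u : Vec n} {v : ℝ}
    (hiff : ∀ β, β ∈ P.multipliers2 xb yb u ↔
        β ∈ P.multipliers xb yb ∧ fderiv ℝ (P.Lmax β) (xb, yb) (u, 0) = v)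
    {h : Vec m} (hh : h ∈ P.linY xb yb u) (hhv : fderiv ℝ P.f (xb, yb) (u, h) = v) {q a : ℝ}
    (hq : ∀ β ∈ P.multipliers2 xb yb u, q ≤ P.hessL xb yb u h β) (ha : a < q) :
    ∀ᶠ t : ℝ in 𝓝[>] 0, a < (P.V yb δ (xb + t • u) - P.V yb δ xb - t * v) / (t ^ 2 / 2) := by
  obtain ⟨k, hk1, hk2, hk3⟩ := hM.exists_second_order hP hiff hh hhv hq
  set d : Vec n × Vec m := (u, h) with hd
  set e : Vec n × Vec m := (0, k) with he
  set x : ℝ → Vec n := fun t => xb + t • u with hx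
  set y : ℝ → Vec m := fun t => yb + t • h + (t ^ 2 / 2) • k with hyd
  have hid : Tendsto (fun t : ℝ => t) (𝓝[>] 0) (𝓝[>] 0) := tendsto_id
  have hid0 : Tendsto (fun t : ℝ => t) (𝓝[>] 0) (𝓝 0) := (tendsto_nhdsWithin_iff.1 hid).1
  have hxt : Tendsto x (𝓝[>] 0) (𝓝 xb) := by
    have : Continuous x := by fun_prop
    simpa [hx] using (this.tendsto 0).mono_left nhdsWithin_le_nhds
  have hyt : Tendsto y (𝓝[>] 0) (𝓝 yb) := by
    have : Continuous y := by fun_prop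
    simpa [hyd] using (this.tendsto 0).mono_left nhdsWithin_le_nhds
  have hz : ∀ t, (x t, y t) = (xb, yb) + t • d + (t ^ 2 / 2) • e := fun t => by
    simp [hx, hyd, hd, he]
  have hw : Tendsto (fun t : ℝ => d + (t / 2) • e) (𝓝[>] 0) (𝓝 d) := by
    have : Continuous fun t : ℝ => d + (t / 2) • e := by fun_prop
    simpa using (this.tendsto 0).mono_left nhdsWithin_le_nhds
  have hz' : ∀ t, (x t, y t) = (xb, yb) + t • (d + (t / 2) • e) := fun t => by
    rw [hz, smul_add, smul_smul, add_assoc]; congr 3; ring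
  have hσ : Tendsto (fun t : ℝ => t ^ 2) (𝓝[>] 0) (𝓝[>] 0) := by
    refine tendsto_nhdsWithin_iff.2 ⟨by simpa using hid0.pow 2, ?_⟩
    filter_upwards [self_mem_nhdsWithin] with t ht
    have ht' : (0 : ℝ) < t := ht
    exact pow_pos ht' 2
  obtain ⟨y', hy', hlim⟩ := hM.exists_correction hP hy hxt hyt hσ
    (fun i ε hε => by
      have hneg : ∀ᶠ t in 𝓝[>] 0, P.innerIneq i (x t, y t) < 0 →
          P.innerIneq i (x t, y t) ≤ ε * t ^ 2 := by
        filter_upwards [self_mem_nhdsWithin] with t ht hlt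
        exact hlt.le.trans (by positivity)
      -- Inactive constraints and those strictly decreasing to first order stay negative; for the
      -- others the acceleration `k` makes the second-order term nonpositive.
      by_cases hi : P.innerIneq i (xb, yb) = 0
      · rcases (hh.1 i hi).lt_or_eq with hlt | heq
        · have h1 := (hP.differentiable_innerIneq i (xb, yb)).hasFDerivAt.tendsto_div hid hw
          filter_upwards [h1.eventually_lt_const hlt, self_mem_nhdsWithin, hneg] with t ht h0 hn
          have h0' : (0 : ℝ) < t := h0
          rw [hi, sub_zero, ← hz', div_lt_iff₀ h0', zero_mul] at ht
          exact hn ht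
        · have h1 := (hP.2.2.2.1 i).tendsto_parabola (xb, yb) d e
          filter_upwards [h1.eventually_lt_const ((hk1 i hi heq).trans_lt
            (show 0 < 2 * ε by positivity)), self_mem_nhdsWithin] with t ht h0
          have h0' : (0 : ℝ) < t := h0
          rw [hi, heq, ← hz, div_lt_iff₀ (by positivity)] at ht
          linarith
      · have hlt : P.innerIneq i (xb, yb) < 0 := lt_of_le_of_ne (hy.1 i) hi
        have hc : Tendsto (fun t : ℝ => P.innerIneq i (x t, y t)) (𝓝[>] 0)
            (𝓝 (P.innerIneq i (xb, yb))) :=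
          ((hP.differentiable_innerIneq i).continuous.tendsto _).comp (hxt.prodMk_nhds hyt)
        filter_upwards [hc.eventually_lt_const hlt, hneg] with t ht hn using hn ht)
    (fun j ε hε => by
      have h1 := (hP.2.2.2.2 j).tendsto_parabola (xb, yb) d e
      rw [hk2 j] at h1
      filter_upwards [h1.abs.eventually_lt_const (show |(0 : ℝ)| < 2 * ε by
        rw [abs_zero]; positivity), self_mem_nhdsWithin] with t ht h0
      have h0' : (0 : ℝ) < t := h0
      have h2 : (0 : ℝ) < t ^ 2 / 2 := by positivity
      rw [hy.2 j, hh.2 j, ← hz, abs_div, abs_of_pos h2, div_lt_iff₀ h2] at ht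
      simp only [sub_zero, mul_zero] at ht
      linarith)
  set c : ℝ → Vec m := fun t => (t ^ 2)⁻¹ • (y' t - y t) with hc
  have hw' : Tendsto (fun t : ℝ => d + (t / 2) • e + t • ((0 : Vec n), c t)) (𝓝[>] 0) (𝓝 d) := by
    have h1 : Tendsto (fun t : ℝ => ((0 : Vec n), c t)) (𝓝[>] 0) (𝓝 (0, 0)) :=
      tendsto_const_nhds.prodMk_nhds hlim
    have h2 := hw.add (hid0.smul h1)
    simpa using h2
  -- The corrected point lies on a ray with moving direction again; the correction changes that
  -- direction by `t • c t` with `c t → 0`, hence drops out of the second-order limit.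
  have hz'' : ∀ t > 0, (x t, y' t) = (xb, yb) + t • (d + (t / 2) • e + t • ((0 : Vec n), c t)) := by
    intro t ht
    rw [smul_add, ← add_assoc, ← hz', smul_smul]
    have : (t * t) • c t = y' t - y t := by
      simp only [hc, smul_smul]
      rw [show t * t * (t ^ 2)⁻¹ = 1 by field_simp, one_smul]
    simp [this]
  have hquot : Tendsto (fun t => (P.f (x t, y' t) - P.f (xb, yb) - t * v) / (t ^ 2 / 2))
      (𝓝[>] 0) (𝓝 (fderiv ℝ P.f (xb, yb) e + fderiv ℝ (fderiv ℝ P.f) (xb, yb) d d)) := by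
    have h1 := hP.1.tendsto_div_pow_two (xb, yb) hid hw'
    have h2 : Tendsto (fun t => fderiv ℝ P.f (xb, yb) (0, c t)) (𝓝[>] 0) (𝓝 0) := by
      have : Continuous fun c : Vec m => fderiv ℝ P.f (xb, yb) (0, c) := by fun_prop
      have h3 := (this.tendsto 0).comp hlim
      rw [show fderiv ℝ P.f (xb, yb) (0, (0 : Vec m)) = 0 from map_zero _] at h3
      exact h3
    have h3 := (h1.add ((h2.const_mul 2).add_const (fderiv ℝ P.f (xb, yb) e)))
    rw [mul_zero, zero_add, add_comm] at h3
    refine h3.congr' ?_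
    filter_upwards [self_mem_nhdsWithin] with t ht
    have ht' : (0 : ℝ) < t := ht
    rw [← hz'' t ht']
    simp only [map_add, map_smul, smul_eq_mul]
    rw [hhv]
    field_simp
    ring
  have hy't : Tendsto y' (𝓝[>] 0) (𝓝 yb) := by
    have h1 := hyt.add ((tendsto_nhdsWithin_iff.1 hσ).1.smul hlim)
    rw [zero_smul, add_zero] at h1
    refine h1.congr' ?_
    filter_upwards [self_mem_nhdsWithin] with t ht
    have ht' : (0 : ℝ) < t := ht
    rw [smul_smul, mul_inv_cancel₀ (pow_pos ht' 2).ne', one_smul]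
    abel
  filter_upwards [hquot.eventually_const_lt (ha.trans_le hk3), hy',
    hy't (Metric.closedBall_mem_nhds yb hδ), self_mem_nhdsWithin] with t h1 h2 h3 ht
  have ht' : (0 : ℝ) < t := ht
  refine h1.trans_le ?_
  have := hP.le_V (δ := δ) (x := x t) (y := y' t) ⟨h2, h3⟩
  rw [hVb]
  gcongr

/-- Upper second-order estimate for the value function. -/
theorem SSOSC.eventually_second_quotient_lt (hP : P.IsC2) (hy : yb ∈ P.Y xb)
    (hM : P.MFCQ xb yb) {δ : ℝ} (hδ : 0 < δ) (hS : P.S yb δ xb = {yb}) {u : Vec n}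
    (hu : P.SSOSC xb yb u) {v : ℝ}
    (hv : ∀ β ∈ P.multipliers2 xb yb u, fderiv ℝ (P.Lmax β) (xb, yb) (u, 0) = v) {a : ℝ}
    (ha : ∀ h ∈ P.linY xb yb u, v ≤ fderiv ℝ P.f (xb, yb) (u, h) →
      ∃ β ∈ P.multipliers2 xb yb u, P.hessL xb yb u h β < a) :
    ∀ᶠ t : ℝ in 𝓝[>] 0, (P.V yb δ (xb + t • u) - P.V yb δ xb - t * v) / (t ^ 2 / 2) < a := by
  have hVb : P.V yb δ xb = P.f (xb, yb) := V_eq_of_mem_S (by rw [hS]; rfl)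
  have hxt : Tendsto (fun t : ℝ => xb + t • u) (𝓝[>] 0) (𝓝 xb) := by
    have : Continuous fun t : ℝ => xb + t • u := by fun_prop
    simpa using (this.tendsto 0).mono_left nhdsWithin_le_nhds
  by_contra hcon
  rw [not_eventually] at hcon
  obtain ⟨t, ht, htp⟩ := exists_seq_forall_of_frequently
    (hcon.and_eventually ((hxt.eventually (hM.eventually_nonempty_S hP hy hδ)).and
      self_mem_nhdsWithin))
  have htpos : ∀ k, 0 < t k := fun k => (htp k).2.2
  choose y hyS using fun k => (htp k).2.1
  have ht0 : Tendsto t atTop (𝓝 0) := (tendsto_nhdsWithin_iff.1 ht).1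
  have hytend : Tendsto y atTop (𝓝 yb) := by
    rw [Metric.tendsto_nhds]
    intro ε hε
    filter_upwards [ht.eventually (hxt.eventually (hM.eventually_S_subset hP hy hδ hS hε))]
      with k hk
    rw [dist_eq_norm]
    exact hk _ (hyS k)
  have hlow : ∀ k, t k * v + a * (t k ^ 2 / 2) ≤ P.f (xb + t k • u, y k) - P.f (xb, yb) := by
    intro k
    have h1 := not_lt.1 (htp k).1
    rw [hVb, V_eq_of_mem_S (hyS k), le_div_iff₀ (by have := htpos k; positivity)] at h1
    linarith
  -- Normalizing time and displacement together covers displacements much larger than `t`; that case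
  -- appears as `τ = 0`.
  set s : ℕ → ℝ := fun k => ‖(t k, y k - yb)‖ with hs
  have hspos : ∀ k, 0 < s k := fun k => norm_pos_iff.2 fun h =>
    (htpos k).ne' (Prod.ext_iff.1 h).1
  have hs0 : Tendsto s atTop (𝓝 0) := by
    have h1 : Tendsto (fun k => (t k, y k - yb)) atTop (𝓝 (0, yb - yb)) :=
      ht0.prodMk_nhds (hytend.sub_const yb)
    rw [sub_self] at h1
    have h2 := h1.norm
    rwa [show ((0 : ℝ), (0 : Vec m)) = 0 from rfl, norm_zero] at h2
  obtain ⟨⟨τ, η⟩, hτη, φ, hφ, hlim⟩ := (isCompact_sphere (0 : ℝ × Vec m) 1).tendsto_subseq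
    (x := fun k => (s k)⁻¹ • (t k, y k - yb)) (fun k => by
      rw [mem_sphere_zero_iff_norm, norm_smul, norm_inv, Real.norm_of_nonneg (hspos k).le]
      exact inv_mul_cancel₀ (hspos k).ne')
  set σ : ℕ → ℝ := fun k => s (φ k) with hσ
  set τ' : ℕ → ℝ := fun k => (s (φ k))⁻¹ * t (φ k) with hτ'
  set η' : ℕ → Vec m := fun k => (s (φ k))⁻¹ • (y (φ k) - yb) with hη'
  have hτlim : Tendsto τ' atTop (𝓝 τ) := (Prod.tendsto_iff _ _).1 hlim |>.1
  have hηlim : Tendsto η' atTop (𝓝 η) := (Prod.tendsto_iff _ _).1 hlim |>.2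
  have hσlim : Tendsto σ atTop (𝓝[>] 0) := tendsto_nhdsWithin_iff.2
    ⟨hs0.comp hφ.tendsto_atTop, Eventually.of_forall fun k => hspos _⟩
  have hwlim : Tendsto (fun k => (τ' k • u, η' k)) atTop (𝓝 (τ • u, η)) :=
    (hτlim.smul_const u).prodMk_nhds hηlim
  have hz : ∀ k, (xb, yb) + σ k • (τ' k • u, η' k) = (xb + t (φ k) • u, y (φ k)) := fun k => by
    have h0 : s (φ k) ≠ 0 := (hspos _).ne'
    simp only [hσ, hτ', hη', Prod.smul_mk, smul_smul, Prod.mk_add_mk]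
    rw [← mul_assoc, mul_inv_cancel₀ h0, one_mul, one_smul, add_sub_cancel]
  have hτ0 : 0 ≤ τ := ge_of_tendsto hτlim (Eventually.of_forall fun k =>
    (mul_pos (inv_pos.2 (hspos _)) (htpos _)).le)
  have hI : ∀ i, P.innerIneq i (xb, yb) = 0 →
      fderiv ℝ (P.innerIneq i) (xb, yb) (τ • u, η) ≤ 0 := by
    intro i hi
    refine le_of_tendsto ((hP.differentiable_innerIneq i (xb, yb)).hasFDerivAt.tendsto_div
      hσlim hwlim) (Eventually.of_forall fun k => ?_)
    rw [hz, hi, sub_zero]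
    exact div_nonpos_of_nonpos_of_nonneg ((hyS (φ k)).1.1.1 i) (hspos _).le
  have hE : ∀ j, fderiv ℝ (P.innerEq j) (xb, yb) (τ • u, η) = 0 := by
    intro j
    refine tendsto_nhds_unique ((hP.differentiable_innerEq j (xb, yb)).hasFDerivAt.tendsto_div
      hσlim hwlim) (tendsto_const_nhds.congr fun k => ?_)
    rw [hz, hy.2 j, (hyS (φ k)).1.1.2 j, sub_zero, zero_div]
  have hF : τ * v ≤ fderiv ℝ P.f (xb, yb) (τ • u, η) := by
    have h1 : Tendsto (fun k => τ' k * v + a / 2 * (τ' k * t (φ k))) atTop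
        (𝓝 (τ * v + a / 2 * (τ * 0))) :=
      (hτlim.mul_const v).add ((hτlim.mul (ht0.comp hφ.tendsto_atTop)).const_mul _)
    rw [mul_zero, mul_zero, add_zero] at h1
    refine le_of_tendsto_of_tendsto' h1
      ((hP.1.differentiable (by norm_num) (xb, yb)).hasFDerivAt.tendsto_div hσlim hwlim)
      fun k => ?_
    rw [hz, le_div_iff₀ (hspos _)]
    refine le_trans (le_of_eq ?_) (hlow (φ k))
    have h0 : s (φ k) ≠ 0 := (hspos _).ne'
    simp only [hτ']
    field_simp
  -- Since `L` equals `f` at the base point and dominates it at feasible points, it inherits the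
  -- lower bound `hlow`. Stationarity in `y` reduces its first-order term to exactly `t v`, which
  -- cancels.
  have hH : ∀ β ∈ P.multipliers2 xb yb u, τ ^ 2 * a ≤ P.hessL xb yb (τ • u) η β := by
    intro β hβ
    obtain ⟨hβ0, hβc, hβL⟩ := hP.mem_multipliers_iff.1 hβ.1
    refine le_of_tendsto_of_tendsto' ((hτlim.pow 2).mul_const a)
      ((hP.Lmax β).tendsto_div_pow_two (xb, yb) hσlim hwlim) fun k => ?_
    have e1 : fderiv ℝ (P.Lmax β) (xb, yb) (τ' k • u, η' k) = τ' k * v := by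
      rw [ContinuousLinearMap.map_prodMk_eq_add, hβL, add_zero, ← hv β hβ,
        show (τ' k • u, (0 : Vec m)) = τ' k • (u, 0) by simp, map_smul, smul_eq_mul]
    have e2 : P.Lmax β (xb, yb) = P.f (xb, yb) := by simp [Lmax, hβc, hy.2]
    have e3 : P.f (xb + t (φ k) • u, y (φ k)) ≤ P.Lmax β (xb + t (φ k) • u, y (φ k)) := by
      have : ∑ i, β.1 i * P.innerIneq i (xb + t (φ k) • u, y (φ k)) ≤ 0 :=
        Finset.sum_nonpos fun i _ =>
          mul_nonpos_of_nonneg_of_nonpos (hβ0 i) ((hyS (φ k)).1.1.1 i)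
      simp only [Lmax, (hyS (φ k)).1.1.2, mul_zero, Finset.sum_const_zero, add_zero]
      linarith
    rw [hz, e1, e2, le_div_iff₀ (by have := hspos (φ k); simp only [hσ]; positivity)]
    have h0 : s (φ k) ≠ 0 := (hspos _).ne'
    have e4 : τ' k ^ 2 * a * (σ k ^ 2 / 2) = a * (t (φ k) ^ 2 / 2) := by
      simp only [hτ', hσ]; field_simp
    have e5 : σ k * (τ' k * v) = t (φ k) * v := by
      simp only [hτ', hσ]; field_simp
    have := hlow (φ k)
    linarith
  rcases hτ0.eq_or_lt with h0 | hpos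
  · subst h0
    simp only [zero_smul, zero_mul, zero_pow two_ne_zero] at hI hE hF hH
    have : η = 0 := hu.eq_zero hP hy hM ⟨hI, hE⟩ hF hH
    rw [this] at hτη
    simp at hτη
  · set h := τ⁻¹ • η with hh
    have hη_eq : η = τ • h := by rw [hh, smul_smul, mul_inv_cancel₀ hpos.ne', one_smul]
    have hlin : ∀ g : Vec n × Vec m → ℝ, fderiv ℝ g (xb, yb) (τ • u, η)
        = τ * fderiv ℝ g (xb, yb) (u, h) := fun g => by
      rw [hη_eq, ← Prod.smul_mk, map_smul, smul_eq_mul]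
    simp only [hlin] at hI hE hF
    obtain ⟨β, hβ, hlt⟩ := ha h
      ⟨fun i hi => by have := hI i hi; exact nonpos_of_mul_nonpos_right this hpos,
        fun j => (mul_eq_zero.1 (hE j)).resolve_left hpos.ne'⟩
      (le_of_mul_le_mul_left hF hpos)
    have := hH β hβ
    rw [hη_eq, hessL_smul] at this
    exact absurd (le_of_mul_le_mul_left this (pow_pos hpos 2)) (not_le.2 hlt)

/-- Second-order expansion of the value function in a direction that satisfies `SSOSC`. -/
theorem SSOSC.hasSecondDirDeriv_V (hP : P.IsC2) (hy : yb ∈ P.Y xb)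
    (hM : P.MFCQ xb yb) {δ : ℝ} (hδ : 0 < δ) (hS : P.S yb δ xb = {yb}) {u : Vec n}
    (hu : P.SSOSC xb yb u) :
    ∃ q : Vec m → ℝ,
      (∀ h, IsLeast (P.hessL xb yb u h '' P.multipliers2 xb yb u) (q h)) ∧
      ∃ M : ℝ, IsGreatest (q '' P.linY2 xb yb u) M ∧ HasSecondDirDeriv (P.V yb δ) xb u M := by
  obtain ⟨q, hq, M, hMax⟩ := hu.exists_max_min hP hy hM
  refine ⟨q, hq, M, hMax, ?_⟩
  obtain ⟨v, hv, hiff, -, β₀, hβ₀⟩ := hM.exists_dual_value hP hu.1 u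
  have hβ₀' := (hiff β₀).1 hβ₀
  have hmem := fun h => hM.mem_linY2_iff hP (h := h) hv ⟨β₀, hβ₀'⟩
  have hVb : P.V yb δ xb = P.f (xb, yb) := V_eq_of_mem_S (by rw [hS]; rfl)
  have hlim : Tendsto (fun t : ℝ => (P.V yb δ (xb + t • u) - P.V yb δ xb - t * v) / (t ^ 2 / 2))
      (𝓝[>] 0) (𝓝 M) := by
    refine tendsto_order.2 ⟨fun a ha => ?_, fun a ha => ?_⟩
    · obtain ⟨h, hh, hqh⟩ := hMax.1
      rw [hmem] at hh
      refine hM.eventually_lt_second_quotient hP hy hδ hVb hiff hh.1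
        (le_antisymm ((hP.fderiv_f_le hh.1 hβ₀'.1).trans hβ₀'.2.le) hh.2)
        (fun β hβ => ?_) ha
      rw [← hqh]
      exact (hq h).2 ⟨β, hβ, rfl⟩
    · refine hu.eventually_second_quotient_lt hP hy hM hδ hS (fun β hβ => ((hiff β).1 hβ).2)
        fun h hh hhv => ?_
      obtain ⟨β, hβ, hβq⟩ := (hq h).1
      exact ⟨β, hβ, by rw [hβq]; exact (hMax.2 ⟨h, (hmem h).2 ⟨hh, hhv⟩, rfl⟩).trans_lt ha⟩
  -- A bounded second-order quotient multiplied by `t / 2` vanishes, so `v` is the first directional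
  -- derivative.
  refine ⟨v, ?_, hlim⟩
  have hid : Tendsto (fun t : ℝ => t) (𝓝[>] 0) (𝓝 0) := tendsto_id.mono_left nhdsWithin_le_nhds
  have h1 := ((hid.div_const 2).mul hlim).add_const v
  rw [zero_div, zero_mul, zero_add] at h1
  refine h1.congr' ?_
  filter_upwards [self_mem_nhdsWithin] with t ht
  have ht' : t ≠ 0 := ne_of_gt ht
  field_simp
  ring

end MinimaxData

/-! ### The main theorem. -/

theorem mainTheorem8 {n m p₁ p₂ q₁ q₂ : ℕ} (P : MinimaxData n m p₁ p₂ q₁ q₂)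
    (xb : Vec n) (yb : Vec m) (δ : ℝ)
    (hC2 : P.IsC2) (hx : xb ∈ P.X) (hy : yb ∈ P.Y xb)
    (hMFCQ : P.MFCQ xb yb)
    (hSSOSC : ∀ u ∈ P.Cmin0 xb yb, u ≠ 0 → P.SSOSC xb yb u)
    (hδ : 0 < δ) (hS : P.S yb δ xb = {yb}) :
    -- near `x̄` the maximum defining `V_δ` is attained, and `V_δ` is Lipschitz continuous
    (∃ U ∈ 𝓝 xb,
      (∀ x ∈ U, IsGreatest ((fun y => P.f (x, y)) '' P.localY yb δ x) (P.V yb δ x)) ∧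
      ∃ K : NNReal, LipschitzOnWith K (P.V yb δ) U) ∧
    -- `V_δ` is twice directionally differentiable at `x̄` in the critical directions
    (∀ u ∈ P.Cmin0 xb yb, ∃ d : ℝ, HasSecondDirDeriv (P.V yb δ) xb u d) ∧
    -- the lower bound: for all nonzero `u ∈ Cmin0`, and for any other nonzero `u ∈ Cmin` at which
    -- `SSOSC` holds as well (`hSSOSC` covers only `Cmin0`)
    (∀ u ∈ P.Cmin xb yb, u ≠ 0 → (u ∈ P.Cmin0 xb yb ∨ P.SSOSC xb yb u) →
      ∃ d : ℝ, HasSecondDirDeriv (P.V yb δ) xb u d ∧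
        ∃ q : Vec m → ℝ,
          (∀ h ∈ P.linY2 xb yb u,
            IsLeast (P.hessL xb yb u h '' P.multipliers2 xb yb u) (q h)) ∧
          ∃ M : ℝ, IsGreatest (q '' P.linY2 xb yb u) M ∧ M ≤ d) := by
  refine ⟨hMFCQ.lipschitz_V hC2 hy hδ hS, fun u hu => ?_, fun u _ hu0 hor => ?_⟩
  · by_cases hu0 : u = 0
    · subst hu0
      -- SSOSC is assumed only for nonzero directions; along `u = 0` both quotients are identically
      -- zero.
      exact ⟨0, 0, by simp [HasDirDeriv], by simp⟩
    · obtain ⟨_, _, M, _, hd⟩ := (hSSOSC u hu hu0).hasSecondDirDeriv_V hC2 hy hMFCQ hδ hS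
      exact ⟨M, hd⟩
  · have hSS : P.SSOSC xb yb u := hor.elim (fun h => hSSOSC u h hu0) id
    obtain ⟨q, hq, M, hMax, hd⟩ := hSS.hasSecondDirDeriv_V hC2 hy hMFCQ hδ hS
    exact ⟨M, hd, q, fun h _ => hq h, M, hMax, le_rfl⟩
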